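/- Let $\mathcal H$ and $\mathcal K$ be separable infinite-dimensional complex Hilbert spaces. Let $\mathcal N_0$ be a continuous nest on $\mathcal H$, that is, a linearly ordered, weakly closed set of projections that contains $0$ and $I$ and has no atoms, and suppose that $\mathcal N_0$ is multiplicity free, that is, $\mathcal N_0''$ has a cyclic and separating vector. Let $E_0$ be a spectral measure of $\mathcal N_0$ on $[0,1]$: a projection-valued Borel measure on $[0,1]$ with $\mathcal N_0=\{E_0([0,t]) : t\in[0,1]\}$ whose null sets are exactly the Lebesgue null sets. Let $(\epsilon_i)_{i\in\mathbb N}$ be an orthonormal basis of $\mathcal K$. On the Hilbert space tensor product $\mathcal H\otimes\mathcal K$ put $N_t:=E_0([0,t])\otimes I$ for $t\in[0,1]$, $N_t:=0$ for $t<0$, $N_t:=I$ for $t>1$, put $\mathcal N:=\{N_t : t\in[0,1]\}$ and $E_i:=I\otimes\epsilon_i\epsilon_i^*$, and let $\mathrm{Alg}\,\mathcal N$ be the set of bounded operators that leave the range of every $N_t$ invariant. For a bounded operator $X$ and $x\in[0,1]$ let \[ i_x(X):=\inf\{\|(N_t-N_s)X(N_t-N_s)\| : s<x<t\}. \] A triangular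 system is a family $\mathbf S=(S_{i,j})_{i,j\in\mathbb N}$ of Borel subsets of $[0,1]$ such that $S_{i,i}=[0,1]$ for all $i$, $S_{i,j}\cap S_{j,i}=\emptyset$ for all $i\neq j$, and $S_{i,j}\cap S_{j,k}\subseteq S_{i,k}$ for all $i,j,k$. Let $\mathcal T(\mathbf S)$ be the set of all $X\in\mathrm{Alg}\,\mathcal N$ such that, for all $i,j$, $i_x(E_iXE_j)=0$ for almost every $x\notin S_{i,j}$. Then for every triangular system $\mathbf S$: 1. $\mathcal T(\mathbf S)$ is a norm-closed triangular space; that is, it is a norm-closed linear space and $\mathcal T(\mathbf S)\cap\mathcal T(\mathbf S)^*$ is a masa (a maximal abelian self-adjoint subalgebra of $B(\mathcal H\otimes\mathcal K)$). 2. $\mathcal T(\mathbf S)$ is not closed under multiplication. More precisely, for all $i,j\in\mathbb N$ there are $X,Y\in\mathcal T(\mathbf S)$ with $X=E_iX$, $Y=YE_j$ and \[ i_x(E_iXYE_j)\ge 1\quad\text{for all } x\in[0,1], \] of the form $X=\sum_n\langle\,\cdot\,,\beta_n\rangle\alpha_n$ and $Y=\sum_n\langle\,\cdot\,,\gamma_n\rangle\beta_n$,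 strongly convergent sums of rank-one operators with orthonormal sequences $(\alpha_n)$, $(\beta_n)$, $(\gamma_n)$. -/

import Mathlib

open MeasureTheory
open scoped TensorProduct InnerProductSpace unitInterval

noncomputable section

namespace TriangularSpaces

/-! ### The Hilbert space tensor product -/

section Tensor

variable {H K : Type*}
  [NormedAddCommGroup H] [InnerProductSpace ℂ H]
  [NormedAddCommGroup K] [InnerProductSpace ℂ K]

/-- The Hilbert space tensor product: the completion of the algebraic tensor product for the
inner product `⟪x ⊗ y, x' ⊗ y'⟫ = ⟪x, x'⟫ ⟪y, y'⟫`. -/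
abbrev HilbertTensor (H K : Type*)
    [NormedAddCommGroup H] [InnerProductSpace ℂ H]
    [NormedAddCommGroup K] [InnerProductSpace ℂ K] : Type _ :=
  UniformSpace.Completion (H ⊗[ℂ] K)

theorem exists_orthonormal_sum (x : H ⊗[ℂ] K) :
    ∃ (n : ℕ) (a : Fin n → H) (b : Fin n → K), Orthonormal ℂ b ∧ x = ∑ i, a i ⊗ₜ[ℂ] b i := by
  obtain ⟨F, hF, hx⟩ := TensorProduct.exists_finite_submodule_right_of_setFinite
    {x} (Set.finite_singleton x)
  obtain ⟨y, rfl⟩ := Set.singleton_subset_iff.mp hx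
  let b := stdOrthonormalBasis ℂ F
  refine ⟨_, fun i => TensorProduct.equivFinsuppOfBasisRight b.toBasis y i,
    fun i => (b i : K), ?_, ?_⟩
  · exact b.orthonormal.comp_linearIsometry F.subtypeₗᵢ
  · have : y = ∑ i, TensorProduct.equivFinsuppOfBasisRight b.toBasis y i ⊗ₜ[ℂ] b i := by
      conv_lhs => rw [← (TensorProduct.equivFinsuppOfBasisRight b.toBasis).symm_apply_apply y]
      rw [TensorProduct.equivFinsuppOfBasisRight_symm_apply, Finsupp.sum_fintype _ _ (by simp)]
      simp
    conv_lhs => rw [this]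
    simp

theorem norm_sq_sum_tmul {n : ℕ} (a : Fin n → H) {b : Fin n → K} (hb : Orthonormal ℂ b) :
    ‖∑ i, a i ⊗ₜ[ℂ] b i‖ ^ 2 = ∑ i, ‖a i‖ ^ 2 := by
  have h : inner ℂ (∑ i, a i ⊗ₜ[ℂ] b i) (∑ i, a i ⊗ₜ[ℂ] b i) = ∑ i, inner ℂ (a i) (a i) := by
    simp only [sum_inner, inner_sum, TensorProduct.inner_tmul, orthonormal_iff_ite.mp hb]
    simp
  rw [Finset.sum_congr rfl fun i _ => inner_self_eq_norm_sq_to_K (𝕜 := ℂ) (a i)] at h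
  replace h := (inner_self_eq_norm_sq_to_K (𝕜 := ℂ) (∑ i, a i ⊗ₜ[ℂ] b i)).symm.trans h
  exact Complex.ofReal_injective (by push_cast; exact h)

theorem norm_rTensor_le (A : H →L[ℂ] H) (x : H ⊗[ℂ] K) :
    ‖(A : H →ₗ[ℂ] H).rTensor K x‖ ≤ ‖A‖ * ‖x‖ := by
  obtain ⟨n, a, b, hb, rfl⟩ := exists_orthonormal_sum x
  refine (sq_le_sq₀ (norm_nonneg _) ?_).mp ?_
  · positivity
  simp only [map_sum, LinearMap.rTensor_tmul, ContinuousLinearMap.coe_coe]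
  rw [mul_pow, norm_sq_sum_tmul _ hb, norm_sq_sum_tmul _ hb, Finset.mul_sum]
  refine Finset.sum_le_sum fun i _ => ?_
  rw [← mul_pow]
  gcongr
  exact A.le_opNorm _

theorem norm_lTensor_le (B : K →L[ℂ] K) (x : H ⊗[ℂ] K) :
    ‖(B : K →ₗ[ℂ] K).lTensor H x‖ ≤ ‖B‖ * ‖x‖ := by
  have h := norm_rTensor_le B (TensorProduct.comm ℂ H K x)
  rw [← LinearMap.comm_comp_lTensor_comp_comm_eq] at h
  simpa using h

/-- The bounded operator `A ⊗ B` on the Hilbert space tensor product. -/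
def tensorOp (A : H →L[ℂ] H) (B : K →L[ℂ] K) : HilbertTensor H K →L[ℂ] HilbertTensor H K :=
  (((A : H →ₗ[ℂ] H).rTensor K).mkContinuous ‖A‖ (norm_rTensor_le A) ∘L
    ((B : K →ₗ[ℂ] K).lTensor H).mkContinuous ‖B‖ (norm_lTensor_le B)).completion

theorem tensorOp_tmul (A : H →L[ℂ] H) (B : K →L[ℂ] K) (x : H) (y : K) :
    tensorOp A B ((x ⊗ₜ[ℂ] y : H ⊗[ℂ] K) : HilbertTensor H K) =
      ((A x ⊗ₜ[ℂ] B y : H ⊗[ℂ] K) : HilbertTensor H K) := by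
  simp [tensorOp]

end Tensor

/-! ### Nests, nest algebras, masas -/

section Operators

variable {G : Type*} [NormedAddCommGroup G] [InnerProductSpace ℂ G] [CompleteSpace G]

/-- A nest: a linearly ordered, weakly closed set of projections containing `0` and `1`. -/
structure IsNest (𝒩 : Set (G →L[ℂ] G)) : Prop where
  isStarProjection : ∀ P ∈ 𝒩, IsStarProjection P
  total : ∀ P ∈ 𝒩, ∀ Q ∈ 𝒩, P ≤ Q ∨ Q ≤ P
  zero_mem : (0 : G →L[ℂ] G) ∈ 𝒩
  one_mem : (1 : G →L[ℂ] G) ∈ 𝒩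
  weakly_closed : IsClosed {A : G →WOT[ℂ] G | A.toCLM ∈ 𝒩}

/-- `Q - P` is an atom of `𝒩`: a minimal one among the intervals of `𝒩`. -/
def IsAtomOfNest (𝒩 : Set (G →L[ℂ] G)) (P Q : G →L[ℂ] G) : Prop :=
  P ∈ 𝒩 ∧ Q ∈ 𝒩 ∧ P < Q ∧
    ∀ P' ∈ 𝒩, ∀ Q' ∈ 𝒩, P' < Q' → Q' - P' ≤ Q - P → Q' - P' = Q - P

/-- A continuous nest: one without atoms. -/
def IsContinuousNest (𝒩 : Set (G →L[ℂ] G)) : Prop :=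
  IsNest 𝒩 ∧ ∀ P Q, ¬ IsAtomOfNest 𝒩 P Q

/-- A nest is multiplicity free if the von Neumann algebra `𝒩''` that it generates has a cyclic
and separating vector. -/
def IsMultiplicityFree (𝒩 : Set (G →L[ℂ] G)) : Prop :=
  ∃ ξ : G, Dense {v : G | ∃ A ∈ Set.centralizer (Set.centralizer 𝒩), A ξ = v} ∧
    ∀ A ∈ Set.centralizer (Set.centralizer 𝒩), A ξ = 0 → A = 0

/-- The nest algebra `Alg 𝒩`: the bounded operators that leave the ranges of `𝒩` invariant. -/
def nestAlgebra (𝒩 : Set (G →L[ℂ] G)) : Set (G →L[ℂ] G) :=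
  {X | ∀ P ∈ 𝒩, ∀ v ∈ Set.range P, X v ∈ Set.range P}

/-- A masa: a maximal abelian self-adjoint subalgebra of `B(G)`. -/
def IsMasa (𝒜 : Set (G →L[ℂ] G)) : Prop :=
  ∃ A : StarSubalgebra ℂ (G →L[ℂ] G), (A : Set (G →L[ℂ] G)) = 𝒜 ∧
    Maximal (fun B : StarSubalgebra ℂ (G →L[ℂ] G) => ∀ X ∈ B, ∀ Y ∈ B, X * Y = Y * X) A

/-- A triangular space: a linear space `𝒯` of operators such that `𝒯 ∩ 𝒯*` is a masa. -/
def IsTriangularSpace (𝒯 : Set (G →L[ℂ] G)) : Prop :=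
  (∃ V : Submodule ℂ (G →L[ℂ] G), (V : Set (G →L[ℂ] G)) = 𝒯) ∧
    IsMasa (𝒯 ∩ {X | star X ∈ 𝒯})

/-- A projection-valued measure on the Borel sets of `[0, 1]`. -/
structure ProjectionValuedMeasure (G : Type*)
    [NormedAddCommGroup G] [InnerProductSpace ℂ G] [CompleteSpace G] where
  /-- The projection of a set; only its values at Borel sets matter. -/
  toFun : Set I → G →L[ℂ] G
  isStarProjection : ∀ S, MeasurableSet S → IsStarProjection (toFun S)
  univ : toFun Set.univ = 1
  inter : ∀ S T, MeasurableSet S → MeasurableSet T → toFun (S ∩ T) = toFun S * toFun T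
  iUnion : ∀ S : ℕ → Set I, (∀ n, MeasurableSet (S n)) → Pairwise (Function.onFun Disjoint S) →
    ∀ v : G, HasSum (fun n => toFun (S n) v) (toFun (⋃ n, S n) v)

/-- `E` is a spectral measure of the nest `𝒩` on `[0, 1]` with Lebesgue measure: the nest
consists of the projections `E([0, t])`, and the null sets of `E` are the Lebesgue null sets. -/
structure IsSpectralMeasure (E : ProjectionValuedMeasure G) (𝒩 : Set (G →L[ℂ] G)) : Prop where
  nest_eq : 𝒩 = Set.range fun t : I => E.toFun (Set.Iic t)
  null_iff : ∀ S, MeasurableSet S → (E.toFun S = 0 ↔ volume S = 0)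

/-- The diagonal seminorm `i_x(X) = inf {‖(N_t - N_s) X (N_t - N_s)‖ : s < x < t}` for projections
`N_t` indexed by the real line. -/
def diagSeminorm (N : ℝ → G →L[ℂ] G) (x : ℝ) (X : G →L[ℂ] G) : ℝ :=
  sInf {r : ℝ | ∃ s t : ℝ, s < x ∧ x < t ∧ r = ‖(N t - N s) * X * (N t - N s)‖}

end Operators

/-! ### Triangular systems and the space `𝒯(S)` -/

/-- A triangular system of Borel subsets of `[0, 1]`. -/
structure IsTriangularSystem (S : ℕ → ℕ → Set I) : Prop where
  measurableSet : ∀ i j, MeasurableSet (S i j)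
  refl : ∀ i, S i i = Set.univ
  antisymm : ∀ i j, i ≠ j → S i j ∩ S j i = ∅
  trans : ∀ i j k, S i j ∩ S j k ⊆ S i k

section Spaces

variable {H K : Type*}
  [NormedAddCommGroup H] [InnerProductSpace ℂ H] [CompleteSpace H]
  [NormedAddCommGroup K] [InnerProductSpace ℂ K] [CompleteSpace K]

/-- The ampliation `𝒩₀ ⊗ I_K` of a nest. -/
def ampliation (K : Type*) [NormedAddCommGroup K] [InnerProductSpace ℂ K]
    (𝒩₀ : Set (H →L[ℂ] H)) : Set (HilbertTensor H K →L[ℂ] HilbertTensor H K) :=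
  (fun P => tensorOp P (1 : K →L[ℂ] K)) '' 𝒩₀

/-- `N_t = E([0, t]) ⊗ I_K`. The index runs over the real line, so that `N_t = 0` for `t < 0` and
`N_t = I` for `t > 1`; these are the values that make two-sided intervals around the
end points `0` and `1` meaningful. -/
def nestProj (K : Type*) [NormedAddCommGroup K] [InnerProductSpace ℂ K]
    (E : ProjectionValuedMeasure H) (t : ℝ) : HilbertTensor H K →L[ℂ] HilbertTensor H K :=
  tensorOp (E.toFun {u : I | (u : ℝ) ≤ t}) (1 : K →L[ℂ] K)

/-- `E_i = I_H ⊗ (ε_i ⊗ ε_i*)`. -/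
def blockProj (H : Type*) [NormedAddCommGroup H] [InnerProductSpace ℂ H]
    (ε : HilbertBasis ℕ ℂ K) (i : ℕ) : HilbertTensor H K →L[ℂ] HilbertTensor H K :=
  tensorOp (1 : H →L[ℂ] H) (InnerProductSpace.rankOne ℂ (ε i) (ε i))

/-- `𝒯(S)`: the operators `X ∈ Alg 𝒩` with `i_x(E_i X E_j) = 0` for all `i, j` and
almost every `x ∉ S i j`. -/
def systemSpace (𝒩₀ : Set (H →L[ℂ] H)) (E : ProjectionValuedMeasure H) (ε : HilbertBasis ℕ ℂ K)
    (S : ℕ → ℕ → Set I) : Set (HilbertTensor H K →L[ℂ] HilbertTensor H K) :=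
  {X | X ∈ nestAlgebra (ampliation K 𝒩₀) ∧
    ∀ i j, ∀ᵐ x : I, x ∉ S i j →
      diagSeminorm (nestProj K E) x (blockProj H ε i * X * blockProj H ε j) = 0}

end Spaces

end TriangularSpaces

end

/-! Diagonal. If `X` and `star X` lie in `𝒯(S)`, both leave the nest invariant, so `X` commutes with
it, and so does each of its blocks, read as an operator on `H`. For `i ≠ j`, almost every `x` lies
outside `S i j` or outside `S j i`. In the first case the `(i, j)` block of `X` has seminorm `0` at
`x`; in the second the `(j, i)` block of `star X` does, and the seminorm condition is invariant
under adjoints. An operator commuting with the nest that is locally small almost everywhere is zero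
(`eq_zero_of_ae_locally_small`): cut `[0, 1]` into countably many pieces on which it has norm at
most `δ` and apply Parseval. Hence the diagonal is the commutant of the nest and the block
projections. It consists of block diagonal operators with blocks in `𝒩₀'`, which is abelian because
`𝒩₀''` is abelian with a cyclic vector (`mul_comm_of_mem_centralizer`).

Products. The basis of `K` is infinite, so infinitely many rank-one operators can be hidden from the
blocks. Enumerate the rational intervals of `[0, 1]`, split the `n`-th into thirds, and choose unit
vectors `a n`, `b n`, `c n` in the spectral subspaces of the left, middle and right third. Place `a
n` in summand `i`, `b n` in summand `n`, `c n` in summand `j`. The order of the thirds puts `X = ∑ a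
n ⊗ (b n)*` and `Y = ∑ b n ⊗ (c n)*` into the nest algebra. Each block of either is a single
rank-one operator, with vanishing seminorm everywhere because `E` has no point masses. But `X * Y`
maps `c n` to `a n` for all `n` inside one block, so that block has norm at least `1` on every
window.

The tensor product enters only through the isometries `h ↦ h ⊗ ε n` and the operators `A ⊗ 1`;
`IsAmpliation` records what is needed of them. -/

namespace TriangularSpaces

/-! ### Commutants of commutative operator families with a cyclic vector -/

section Commutant

variable {G : Type*} [NormedAddCommGroup G] [InnerProductSpace ℂ G] [CompleteSpace G]

theorem norm_star_apply_eq_of_isStarNormal {A : G →L[ℂ] G} (hA : star A * A = A * star A) (v : G) :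
    ‖star A v‖ = ‖A v‖ := by
  have h1 : (inner ℂ (star A v) (star A v) : ℂ) = inner ℂ (A v) (A v) := by
    have h := congrArg (fun B : G →L[ℂ] G => (inner ℂ v (B v) : ℂ)) hA
    simp only [mul_apply_eq_comp, ContinuousLinearMap.star_eq_adjoint,
      ContinuousLinearMap.adjoint_inner_right] at h
    rw [ContinuousLinearMap.star_eq_adjoint, ContinuousLinearMap.adjoint_inner_left, h]
  rw [inner_self_eq_norm_sq_to_K, inner_self_eq_norm_sq_to_K] at h1
  have h2 : ‖star A v‖ ^ 2 = ‖A v‖ ^ 2 := by exact_mod_cast h1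
  exact (sq_eq_sq₀ (norm_nonneg _) (norm_nonneg _)).mp h2

/-- A self-adjoint operator commuting with a commutative self-adjoint set `M` of operators is
approximated by `M` and by the adjoints of the approximants at a vector cyclic for `M`. -/
theorem exists_seq_tendsto_apply_of_commute {M : Set (G →L[ℂ] G)}
    (hstar : ∀ A ∈ M, star A ∈ M) (hcomm : ∀ A ∈ M, ∀ B ∈ M, A * B = B * A) {ξ : G}
    (hξ : Dense {v : G | ∃ A ∈ M, A ξ = v}) {T : G →L[ℂ] G} (hT : star T = T)
    (hTM : ∀ A ∈ M, A * T = T * A) :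
    ∃ A : ℕ → G →L[ℂ] G, (∀ n, A n ∈ M) ∧
      Filter.Tendsto (fun n => A n ξ) Filter.atTop (nhds (T ξ)) ∧
      Filter.Tendsto (fun n => star (A n) ξ) Filter.atTop (nhds (T ξ)) := by
  obtain ⟨x, hx, hlim⟩ := mem_closure_iff_seq_limit.mp (hξ (T ξ))
  choose A hA hAx using hx
  refine ⟨A, hA, by simpa only [hAx] using hlim, ?_⟩
  rw [tendsto_iff_norm_sub_tendsto_zero] at hlim ⊢
  refine hlim.congr fun n => ?_
  have h := norm_star_apply_eq_of_isStarNormal (A := A n - T) (by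
    rw [star_sub, hT, sub_mul, mul_sub, mul_sub, sub_mul, mul_sub, mul_sub,
      hcomm _ (hstar _ (hA n)) _ (hA n), hTM _ (hA n), hTM _ (hstar _ (hA n))]
    abel) ξ
  rw [star_sub, hT] at h
  simpa [hAx] using h.symm

/-- At `ξ`, both `S` and `T` are limits of elements of `M` together with their adjoints.
Commutativity of `M` passes to matrix coefficients between vectors of the dense set `M ξ`. -/
theorem mul_comm_of_cyclic_of_selfAdjoint {M : Set (G →L[ℂ] G)}
    (hstar : ∀ A ∈ M, star A ∈ M) (hcomm : ∀ A ∈ M, ∀ B ∈ M, A * B = B * A) {ξ : G}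
    (hξ : Dense {v : G | ∃ A ∈ M, A ξ = v}) {S T : G →L[ℂ] G} (hS : star S = S) (hT : star T = T)
    (hSM : ∀ A ∈ M, A * S = S * A) (hTM : ∀ A ∈ M, A * T = T * A) : S * T = T * S := by
  obtain ⟨A, hA, hAT, hAT'⟩ := exists_seq_tendsto_apply_of_commute hstar hcomm hξ hT hTM
  obtain ⟨D, hD, hDS, hDS'⟩ := exists_seq_tendsto_apply_of_commute hstar hcomm hξ hS hSM
  have ap : ∀ {P Q : G →L[ℂ] G}, P * Q = Q * P → ∀ v, P (Q v) = Q (P v) := fun h v =>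
    congrArg (fun B : G →L[ℂ] G => B v) h
  have sa : ∀ (P : G →L[ℂ] G) (x y : G), (inner ℂ (P x) y : ℂ) = inner ℂ x (star P y) :=
    fun P x y => by
      rw [ContinuousLinearMap.star_eq_adjoint, ContinuousLinearMap.adjoint_inner_right]
  have key : ∀ B ∈ M, ∀ C ∈ M,
      (inner ℂ (C ξ) ((S * T) (B ξ)) : ℂ) = inner ℂ (C ξ) ((T * S) (B ξ)) := by
    intro B hB C hC
    have l1 : Filter.Tendsto (fun n => (inner ℂ (C (D n ξ)) (B (A n ξ)) : ℂ)) Filter.atTop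
        (nhds (inner ℂ (C (S ξ)) (B (T ξ)))) :=
      ((C.continuous.tendsto _).comp hDS).inner ((B.continuous.tendsto _).comp hAT)
    have l2 : Filter.Tendsto
        (fun n => (inner ℂ (C (star (A n) ξ)) (B (star (D n) ξ)) : ℂ)) Filter.atTop
        (nhds (inner ℂ (C (T ξ)) (B (S ξ)))) :=
      ((C.continuous.tendsto _).comp hAT').inner ((B.continuous.tendsto _).comp hDS')
    -- `A n` and `D n` change sides as adjoints, and all factors lie in the commutative family `M`.
    -- In the limit the two sides become the matrix coefficients of `S * T` and `T * S`.
    have e : ∀ n, (inner ℂ (C (D n ξ)) (B (A n ξ)) : ℂ)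
        = inner ℂ (C (star (A n) ξ)) (B (star (D n) ξ)) := by
      intro n
      rw [ap (hcomm _ hB _ (hA n)), ap (hcomm _ hC _ (hD n)), sa (D n),
        ap (hcomm _ (hstar _ (hD n)) _ (hA n)), ← ap (hcomm _ hB _ (hstar _ (hD n))),
        ap (hcomm _ hC _ (hstar _ (hA n))), sa (star (A n)), star_star]
    have h := tendsto_nhds_unique l1 (l2.congr fun n => (e n).symm)
    rw [ap (hSM _ hC), ap (hTM _ hB), ap (hTM _ hC), ap (hSM _ hB), sa S, hS, sa T, hT] at h
    exact h
  refine ContinuousLinearMap.ext fun v => ?_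
  refine congrFun (Continuous.ext_on hξ (S * T).continuous (T * S).continuous ?_) v
  rintro _ ⟨B, hB, rfl⟩
  refine hξ.eq_of_inner_right ℂ ?_
  rintro _ ⟨C, hC, rfl⟩
  exact key B hB C hC

/-- The commutant of a commuting set of projections whose bicommutant has a cyclic vector is
commutative. -/
theorem mul_comm_of_mem_centralizer {𝒩 : Set (G →L[ℂ] G)}
    (hstar : ∀ P ∈ 𝒩, star P = P) (hcomm : ∀ P ∈ 𝒩, ∀ Q ∈ 𝒩, P * Q = Q * P) {ξ : G}
    (hξ : Dense {v : G | ∃ A ∈ Set.centralizer (Set.centralizer 𝒩), A ξ = v})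
    {S T : G →L[ℂ] G} (hS : S ∈ Set.centralizer 𝒩) (hT : T ∈ Set.centralizer 𝒩) :
    S * T = T * S := by
  have st : ∀ A ∈ Set.centralizer 𝒩, star A ∈ Set.centralizer 𝒩 := fun A hA =>
    Set.star_mem_centralizer' (fun P hP => by rwa [hstar P hP]) hA
  have st2 : ∀ A ∈ Set.centralizer (Set.centralizer 𝒩),
      star A ∈ Set.centralizer (Set.centralizer 𝒩) := fun A hA =>
    Set.star_mem_centralizer' st hA
  have sub : 𝒩 ⊆ Set.centralizer 𝒩 := fun P hP Q hQ => hcomm _ hQ _ hP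
  have sub2 : Set.centralizer (Set.centralizer 𝒩) ⊆ Set.centralizer 𝒩 :=
    Set.centralizer_subset sub
  have com2 : ∀ A ∈ Set.centralizer (Set.centralizer 𝒩),
      ∀ B ∈ Set.centralizer (Set.centralizer 𝒩), A * B = B * A :=
    fun A hA B hB => hB A (sub2 hA)
  have main : ∀ {S T : G →L[ℂ] G}, S ∈ Set.centralizer 𝒩 → T ∈ Set.centralizer 𝒩 →
      star S = S → star T = T → S * T = T * S := fun hS hT hS' hT' =>
    mul_comm_of_cyclic_of_selfAdjoint st2 com2 hξ hS' hT'
      (fun A hA => (hA _ hS).symm) (fun A hA => (hA _ hT).symm)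
  -- The commutant is closed under adjoints, hence under real and imaginary parts, which reduces the
  -- claim to self-adjoint operators.
  have re : ∀ A ∈ Set.centralizer 𝒩, ((realPart A : G →L[ℂ] G)) ∈ Set.centralizer 𝒩 := by
    intro A hA P hP
    have h1 := hA P hP
    have h2 := st A hA P hP
    simp only [realPart_apply_coe, mul_smul_comm, smul_mul_assoc, mul_add, add_mul, h1, h2]
  have im : ∀ A ∈ Set.centralizer 𝒩, ((imaginaryPart A : G →L[ℂ] G)) ∈ Set.centralizer 𝒩 := by
    intro A hA P hP
    have h1 := hA P hP
    have h2 := st A hA P hP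
    simp only [imaginaryPart_apply_coe, mul_smul_comm, smul_mul_assoc, mul_sub, sub_mul, h1, h2]
  have c1 := main (re S hS) (re T hT) (realPart S).2 (realPart T).2
  have c2 := main (re S hS) (im T hT) (realPart S).2 (imaginaryPart T).2
  have c3 := main (im S hS) (re T hT) (imaginaryPart S).2 (realPart T).2
  have c4 := main (im S hS) (im T hT) (imaginaryPart S).2 (imaginaryPart T).2
  rw [← realPart_add_I_smul_imaginaryPart S, ← realPart_add_I_smul_imaginaryPart T]
  simp only [mul_add, add_mul, mul_smul_comm, smul_mul_assoc, smul_add, c1, c2, c3, c4]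
  abel

end Commutant

/-! ### Projection-valued measures on `[0, 1]` and localization of operators -/

section SpectralMeasure

/-- The points of the unit interval in `(s, t]`. -/
def window (s t : ℝ) : Set I := {u : I | s < u ∧ (u : ℝ) ≤ t}

theorem measurableSet_window (s t : ℝ) : MeasurableSet (window s t) :=
  (measurableSet_lt measurable_const measurable_subtype_coe).inter
    (measurableSet_le measurable_subtype_coe measurable_const)

theorem measurableSet_coe_le (t : ℝ) : MeasurableSet {u : I | (u : ℝ) ≤ t} :=
  measurableSet_le measurable_subtype_coe measurable_const

theorem window_subset_window {s t s' t' : ℝ} (hs : s' ≤ s) (ht : t ≤ t') :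
    window s t ⊆ window s' t' := fun _ hu => ⟨hs.trans_lt hu.1, hu.2.trans ht⟩

theorem volume_window_ne_zero {s t : ℝ} (hs : 0 ≤ s) (hst : s < t) (ht : t ≤ 1) :
    volume (window s t) ≠ 0 := by
  have h : window s t = Set.Ioc (⟨s, hs, hst.le.trans ht⟩ : I) ⟨t, hs.trans hst.le, ht⟩ := rfl
  rw [h, unitInterval.volume_Ioc]
  simpa using hst

variable {H : Type*} [NormedAddCommGroup H] [InnerProductSpace ℂ H] [CompleteSpace H]

namespace ProjectionValuedMeasure

variable (E : ProjectionValuedMeasure H)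

theorem empty : E.toFun ∅ = 0 := by
  refine ContinuousLinearMap.ext fun v => ?_
  have h := (E.iUnion (fun _ => ∅) (fun _ => .empty) (fun _ _ _ => disjoint_bot_left) v).summable
  exact tendsto_const_nhds_iff.mp h.tendsto_atTop_zero

open Classical in
/-- The vector measure `S ↦ E(S) v`. -/
noncomputable def vectorMeasure (v : H) : VectorMeasure I H where
  measureOf' S := if MeasurableSet S then E.toFun S v else 0
  empty' := by simp [E.empty]
  not_measurable' S hS := by simp [hS]
  m_iUnion' f hf hd := by
    simpa [hf, MeasurableSet.iUnion hf] using E.iUnion f hf hd v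

theorem vectorMeasure_apply (v : H) {S : Set I} (hS : MeasurableSet S) :
    E.vectorMeasure v S = E.toFun S v := if_pos hS

theorem sdiff {S T : Set I} (hS : MeasurableSet S) (hT : MeasurableSet T) (h : S ⊆ T) :
    E.toFun (T \ S) = E.toFun T - E.toFun S := by
  refine ContinuousLinearMap.ext fun v => ?_
  have := VectorMeasure.of_sdiff (v := E.vectorMeasure v) hS hT h
  simpa [E.vectorMeasure_apply, hS, hT, hT.diff hS] using this

theorem mul_eq_left {S T : Set I} (hS : MeasurableSet S) (hT : MeasurableSet T) (h : S ⊆ T) :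
    E.toFun S * E.toFun T = E.toFun S := by
  rw [← E.inter S T hS hT, Set.inter_eq_left.mpr h]

theorem mul_eq_right {S T : Set I} (hS : MeasurableSet S) (hT : MeasurableSet T) (h : S ⊆ T) :
    E.toFun T * E.toFun S = E.toFun S := by
  rw [← E.inter T S hT hS, Set.inter_eq_right.mpr h]

theorem mul_eq_zero {S T : Set I} (hS : MeasurableSet S) (hT : MeasurableSet T)
    (h : Disjoint S T) : E.toFun S * E.toFun T = 0 := by
  rw [← E.inter S T hS hT, h.inter_eq, E.empty]

theorem inner_apply_left {S : Set I} (hS : MeasurableSet S) (v w : H) :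
    (inner ℂ (E.toFun S v) w : ℂ) = inner ℂ v (E.toFun S w) := by
  have h := (E.isStarProjection S hS).isSelfAdjoint.star_eq
  conv_rhs => rw [← h, ContinuousLinearMap.star_eq_adjoint,
    ContinuousLinearMap.adjoint_inner_right]

theorem norm_apply_le {S : Set I} (hS : MeasurableSet S) : ‖E.toFun S‖ ≤ 1 :=
  (E.isStarProjection S hS).norm_le

theorem inner_apply_self {S : Set I} (hS : MeasurableSet S) (v : H) :
    (inner ℂ v (E.toFun S v) : ℂ) = ((‖E.toFun S v‖ ^ 2 : ℝ) : ℂ) := by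
  have h : E.toFun S (E.toFun S v) = E.toFun S v :=
    congrArg (fun A : H →L[ℂ] H => A v) (E.isStarProjection S hS).isIdempotentElem
  rw [← h, ← E.inner_apply_left hS, h, inner_self_eq_norm_sq_to_K]
  simp

theorem coe_le_sub_coe_le {s t : ℝ} (h : s ≤ t) :
    E.toFun {u : I | (u : ℝ) ≤ t} - E.toFun {u : I | (u : ℝ) ≤ s} = E.toFun (window s t) := by
  rw [← E.sdiff (measurableSet_coe_le s) (measurableSet_coe_le t) fun u hu => le_trans hu h]
  congr 1
  ext u
  simp [window, and_comm]

/-- Parseval's identity for a countable partition into Borel sets of full measure. -/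
theorem hasSum_norm_sq {D : ℕ → Set I} (hD : ∀ n, MeasurableSet (D n))
    (hdisj : Pairwise (Function.onFun Disjoint D)) (hfull : E.toFun (⋃ n, D n) = 1) (v : H) :
    HasSum (fun n => ‖E.toFun (D n) v‖ ^ 2) (‖v‖ ^ 2) := by
  have h := (E.iUnion D hD hdisj v).mapL (innerSL ℂ v)
  rw [hfull] at h
  have hv : (inner ℂ v v : ℂ) = ((‖v‖ ^ 2 : ℝ) : ℂ) := by
    rw [inner_self_eq_norm_sq_to_K]
    simp
  simp only [innerSL_apply_apply, one_apply_eq_self, E.inner_apply_self (hD _), hv] at h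
  exact Complex.hasSum_ofReal.mp h

/-- An operator that commutes with the projections `E([0, t])` commutes with every `E(S)`. -/
theorem commute_of_forall_Iic {Z : H →L[ℂ] H}
    (hZ : ∀ t : I, E.toFun (Set.Iic t) * Z = Z * E.toFun (Set.Iic t))
    {S : Set I} (hS : MeasurableSet S) : E.toFun S * Z = Z * E.toFun S := by
  refine ContinuousLinearMap.ext fun v => ?_
  -- `S ↦ E(S) Z v` and `S ↦ Z E(S) v` are vector measures that agree on the π-system of the sets
  -- `[0, t]`, which generates the Borel sets.
  let μ : VectorMeasure I H :=
    (E.vectorMeasure v).mapRange Z.toLinearMap.toAddMonoidHom Z.continuous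
  have hμ : ∀ S, MeasurableSet S → μ S = Z (E.toFun S v) := fun S hS =>
    congrArg Z (E.vectorMeasure_apply v hS)
  have key : E.vectorMeasure (Z v) = μ := by
    refine VectorMeasure.ext_of_generateFrom (Set.range Set.Iic) ?_ ?_ isPiSystem_Iic ?_
    · rintro _ ⟨t, rfl⟩
      rw [hμ _ measurableSet_Iic, E.vectorMeasure_apply _ measurableSet_Iic]
      exact congrArg (fun A : H →L[ℂ] H => A v) (hZ t)
    · rw [BorelSpace.measurable_eq (α := I), borel_eq_generateFrom_Iic]
    · rw [hμ _ .univ, E.vectorMeasure_apply _ .univ, E.univ]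
      rfl
  have h := congrArg (fun ν => ν S) key
  simp only [hμ S hS, E.vectorMeasure_apply _ hS] at h
  exact h

end ProjectionValuedMeasure

variable {E : ProjectionValuedMeasure H} {𝒩₀ : Set (H →L[ℂ] H)}

namespace IsSpectralMeasure

/-- Windows shrinking to a point have small spectral projections. -/
theorem exists_window_norm_lt (hE : IsSpectralMeasure E 𝒩₀) (x : I) (v : H) {δ : ℝ} (hδ : 0 < δ) :
    ∃ s t : ℝ, s < x ∧ x < t ∧ ‖E.toFun (window s t) v‖ < δ := by
  let r : ℕ → ℝ := fun n => 1 / ((n : ℝ) + 1)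
  have hr : ∀ n, 0 < r n := fun n => Nat.one_div_pos_of_nat
  have hanti : Antitone r := fun m n h => Nat.one_div_le_one_div h
  have hlim := VectorMeasure.tendsto_vectorMeasure_iInter_atTop_nat (v := E.vectorMeasure v)
    (s := fun n => window (x - r n) (x + r n))
    (fun m n h => window_subset_window (by linarith [hanti h]) (by linarith [hanti h]))
    (fun n => measurableSet_window _ _)
  -- The windows decrease to a point, which is Lebesgue null and hence null for `E`.
  have hinter : (⋂ n, window (x - r n) (x + r n)) = {x} := by
    refine Set.eq_singleton_iff_unique_mem.mpr ⟨?_, fun u hu => ?_⟩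
    · exact Set.mem_iInter.mpr fun n => ⟨by linarith [hr n], by linarith [hr n]⟩
    · have h0 : Filter.Tendsto r Filter.atTop (nhds 0) := tendsto_one_div_add_atTop_nhds_zero_nat
      rw [Set.mem_iInter] at hu
      refine Subtype.ext (le_antisymm ?_ ?_)
      · exact ge_of_tendsto' (by simpa using h0.const_add (x : ℝ)) fun n => (hu n).2
      · exact le_of_tendsto' (by simpa using h0.const_sub (x : ℝ)) fun n => (hu n).1.le
  rw [hinter, E.vectorMeasure_apply v (measurableSet_singleton x),
    (hE.null_iff _ (measurableSet_singleton x)).mpr (by simp)] at hlim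
  simp only [E.vectorMeasure_apply v (measurableSet_window _ _)] at hlim
  obtain ⟨n, hn⟩ := (hlim.norm.eventually (gt_mem_nhds (by simpa using hδ))).exists
  exact ⟨x - r n, x + r n, by linarith [hr n], by linarith [hr n], hn⟩

/-- The range of the spectral projection of a nondegenerate window is infinite-dimensional. -/
theorem not_finiteDimensional_range_window (hE : IsSpectralMeasure E 𝒩₀) {s t : ℝ}
    (hs : 0 ≤ s) (hst : s < t) (ht : t ≤ 1) :
    ¬ FiniteDimensional ℂ (E.toFun (window s t)).range := by
  intro hfin
  -- A strictly decreasing sequence starting at `t` and staying above `s`: it cuts infinitely many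
  -- disjoint non-null windows out of `(s, t]`, whose projections supply orthogonal nonzero vectors.
  let r : ℕ → ℝ := fun n => s + (t - s) / ((n : ℝ) + 1)
  have hr : ∀ m n, m < n → r n < r m := fun m n h => by
    have : (t - s) / ((n : ℝ) + 1) < (t - s) / ((m : ℝ) + 1) :=
      div_lt_div_of_pos_left (by linarith) (by positivity) (by exact_mod_cast Nat.succ_lt_succ h)
    simp only [r]
    linarith
  have hrs : ∀ n, s < r n := fun n => by
    have : 0 < (t - s) / ((n : ℝ) + 1) := div_pos (by linarith) (by positivity)
    simp only [r]
    linarith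
  have hr0 : r 0 = t := by simp [r]
  have hrt : ∀ n, r n ≤ t := fun n => by
    rcases Nat.eq_zero_or_pos n with rfl | h
    · exact hr0.le
    · exact hr0 ▸ (hr 0 n h).le
  have hne : ∀ n, ∃ v : H, E.toFun (window (r (n + 1)) (r n)) v ≠ 0 := by
    intro n
    by_contra! h
    have h0 : E.toFun (window (r (n + 1)) (r n)) = 0 := ContinuousLinearMap.ext h
    exact volume_window_ne_zero (hs.trans (hrs _).le) (hr _ _ n.lt_succ_self) ((hrt n).trans ht)
      ((hE.null_iff _ (measurableSet_window _ _)).mp h0)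
  choose v hv using hne
  let w : ℕ → (E.toFun (window s t)).range := fun n =>
    ⟨E.toFun (window (r (n + 1)) (r n)) (v n), E.toFun (window (r (n + 1)) (r n)) (v n), by
      exact congrArg (fun A : H →L[ℂ] H => A (v n)) (E.mul_eq_right (measurableSet_window _ _)
        (measurableSet_window _ _) (window_subset_window (hrs _).le (hrt n)))⟩
  have hlt : ∀ m n, m < n →
      Disjoint (window (r (m + 1)) (r m)) (window (r (n + 1)) (r n)) := by
    intro m n h
    refine Set.disjoint_left.mpr fun u hu hu' => ?_
    have h1 : r n ≤ r (m + 1) := by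
      rcases (Nat.succ_le_of_lt h).eq_or_lt with h | h
      · exact h ▸ le_rfl
      · exact (hr _ _ h).le
    linarith [hu.1, hu'.2]
  have hdisj : ∀ m n, m ≠ n →
      Disjoint (window (r (m + 1)) (r m)) (window (r (n + 1)) (r n)) := fun m n h => by
    rcases lt_or_gt_of_ne h with h | h
    · exact hlt m n h
    · exact (hlt n m h).symm
  have hli : LinearIndependent ℂ w := by
    refine linearIndependent_of_ne_zero_of_inner_eq_zero
      (fun n h => hv n (congrArg Subtype.val h)) fun m n hmn => ?_
    change (inner ℂ (E.toFun (window (r (m + 1)) (r m)) (v m))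
      (E.toFun (window (r (n + 1)) (r n)) (v n)) : ℂ) = 0
    have h0 := congrArg (fun A : H →L[ℂ] H => A (v n)) (E.mul_eq_zero
      (measurableSet_window _ _) (measurableSet_window _ _) (hdisj m n hmn))
    rw [E.inner_apply_left (measurableSet_window _ _)]
    simp only [mul_apply_eq_comp, zero_apply] at h0
    rw [h0, inner_zero_right]
  exact not_finite_iff_infinite.mpr inferInstance hli.finite

/-- An operator in the commutant of the nest that is locally small almost everywhere vanishes. -/
theorem eq_zero_of_ae_locally_small (hE : IsSpectralMeasure E 𝒩₀) {Z : H →L[ℂ] H}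
    (hZ : ∀ t : I, E.toFun (Set.Iic t) * Z = Z * E.toFun (Set.Iic t))
    (hsmall : ∀ᵐ x : I, ∀ δ > 0, ∃ s t : ℝ, s < x ∧ x < t ∧
      ‖E.toFun (window s t) * Z * E.toFun (window s t)‖ < δ) : Z = 0 := by
  classical
  refine norm_le_zero_iff.mp (le_of_forall_pos_le_add fun δ hδ => ?_)
  rw [zero_add]
  -- Rational end points keep the cover countable. Windows on which the compression of `Z` exceeds
  -- `δ` are replaced by `∅`; the rest still cover almost every point.
  obtain ⟨e, he⟩ := exists_surjective_nat (ℚ × ℚ)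
  let W : ℕ → Set I := fun n => if ‖E.toFun (window (e n).1 (e n).2) * Z *
    E.toFun (window (e n).1 (e n).2)‖ ≤ δ then window (e n).1 (e n).2 else ∅
  have hW : ∀ n, MeasurableSet (W n) := fun n => by
    simp only [W]
    split_ifs
    exacts [measurableSet_window _ _, .empty]
  have hWnorm : ∀ n, ‖E.toFun (W n) * Z * E.toFun (W n)‖ ≤ δ := fun n => by
    simp only [W]
    split_ifs with h
    · exact h
    · simpa [E.empty] using hδ.le
  let D : ℕ → Set I := disjointed W
  have hD : ∀ n, MeasurableSet (D n) := fun n => .disjointed (fun n => hW n) n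
  have hfull : E.toFun (⋃ n, D n) = 1 := by
    have hU : MeasurableSet (⋃ n, D n) := .iUnion hD
    have h0 : E.toFun ((⋃ n, D n)ᶜ) = 0 := by
      rw [hE.null_iff _ hU.compl]
      filter_upwards [hsmall] with x hx
      obtain ⟨s, t, hs, ht, hst⟩ := hx δ hδ
      obtain ⟨p, hp1, hp2⟩ := exists_rat_btwn hs
      obtain ⟨q, hq1, hq2⟩ := exists_rat_btwn ht
      obtain ⟨n, hn⟩ := he (p, q)
      have hsub : window p q ⊆ window s t := window_subset_window hp1.le hq2.le
      have hle : ‖E.toFun (window p q) * Z * E.toFun (window p q)‖ ≤ δ := by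
        have e1 : E.toFun (window p q) * Z * E.toFun (window p q) = E.toFun (window p q) *
            (E.toFun (window s t) * Z * E.toFun (window s t)) * E.toFun (window p q) := by
          simp only [mul_assoc]
          rw [E.mul_eq_right (measurableSet_window _ _) (measurableSet_window _ _) hsub,
            ← mul_assoc (E.toFun (window p q)) (E.toFun (window s t)),
            E.mul_eq_left (measurableSet_window _ _) (measurableSet_window _ _) hsub]
        rw [e1]
        have n1 := E.norm_apply_le (measurableSet_window p q)
        calc _ ≤ ‖E.toFun (window p q)‖ * ‖E.toFun (window s t) * Z * E.toFun (window s t)‖ *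
              ‖E.toFun (window p q)‖ := (norm_mul_le _ _).trans (by gcongr; exact norm_mul_le _ _)
          _ ≤ 1 * δ * 1 := by gcongr
          _ = δ := by ring
      have hmem : x ∈ ⋃ n, D n := by
        rw [iUnion_disjointed]
        refine Set.mem_iUnion.mpr ⟨n, ?_⟩
        simp only [W, hn, if_pos hle]
        exact ⟨hp2, hq1.le⟩
      simpa using hmem
    have := E.sdiff hU MeasurableSet.univ (Set.subset_univ _)
    rw [← Set.compl_eq_univ_sdiff, h0, E.univ] at this
    exact (sub_eq_zero.mp this.symm).symm
  refine ContinuousLinearMap.opNorm_le_bound _ hδ.le fun v => ?_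
  refine (sq_le_sq₀ (norm_nonneg _) (by positivity)).mp ?_
  have h1 := E.hasSum_norm_sq hD (disjoint_disjointed W) hfull (Z v)
  have h2 := (E.hasSum_norm_sq hD (disjoint_disjointed W) hfull v).mul_left (δ ^ 2)
  rw [mul_pow]
  refine hasSum_le (fun n => ?_) h1 h2
  rw [← mul_pow]
  refine pow_le_pow_left₀ (norm_nonneg _) ?_ 2
  have hsub : D n ⊆ W n := disjointed_subset W n
  -- Since `Z` commutes with `E (D n)`, this projection may be put on both sides, and `D n ⊆ W n`
  -- then allows the small compression to be inserted.
  have e2 : E.toFun (D n) * Z =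
      E.toFun (D n) * (E.toFun (W n) * Z * E.toFun (W n)) * E.toFun (D n) := by
    simp only [mul_assoc]
    rw [E.mul_eq_right (hD n) (hW n) hsub, ← mul_assoc (E.toFun (D n)) (E.toFun (W n)),
      E.mul_eq_left (hD n) (hW n) hsub, ← E.commute_of_forall_Iic hZ (hD n), ← mul_assoc,
      (E.isStarProjection _ (hD n)).isIdempotentElem.eq]
  have e3 : E.toFun (D n) (Z v) =
      E.toFun (D n) ((E.toFun (W n) * Z * E.toFun (W n)) (E.toFun (D n) v)) :=
    congrArg (fun A : H →L[ℂ] H => A v) e2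
  rw [e3]
  calc _ ≤ 1 * ‖(E.toFun (W n) * Z * E.toFun (W n)) (E.toFun (D n) v)‖ :=
        ContinuousLinearMap.le_of_opNorm_le _ (E.norm_apply_le (hD n)) _
    _ ≤ 1 * (δ * ‖E.toFun (D n) v‖) := by
        gcongr
        exact ContinuousLinearMap.le_of_opNorm_le _ (hWnorm n) _
    _ = _ := one_mul _

end IsSpectralMeasure

end SpectralMeasure

/-! ### Orthonormal sequences and partial isometries -/

section Orthonormal

variable {H : Type*} [NormedAddCommGroup H] [InnerProductSpace ℂ H]

/-- The orthogonal projection onto the span of `L` has finite-dimensional range, so it cannot be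
injective on `V`; a normalized kernel vector serves. -/
theorem exists_unit_mem_orthogonal {V : Submodule ℂ H} (hV : ¬ FiniteDimensional ℂ V)
    (L : Finset H) : ∃ e ∈ V, ‖e‖ = 1 ∧ ∀ f ∈ L, (inner ℂ f e : ℂ) = 0 := by
  let F : Submodule ℂ H := Submodule.span ℂ (L : Set H)
  have hF : FiniteDimensional ℂ F := FiniteDimensional.span_finset ℂ L
  let φ : V →ₗ[ℂ] F := F.orthogonalProjectionOnto.toLinearMap ∘ₗ V.subtype
  have hφ : ¬ Function.Injective φ := fun h => hV (FiniteDimensional.of_injective φ h)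
  rw [← LinearMap.ker_eq_bot, Submodule.eq_bot_iff] at hφ
  push Not at hφ
  obtain ⟨v, hv, hv0⟩ := hφ
  have hv0' : (v : H) ≠ 0 := fun h => hv0 (Subtype.ext h)
  have hvF : (v : H) ∈ Fᗮ := Submodule.orthogonalProjectionOnto_eq_zero_iff.mp hv
  refine ⟨((‖(v : H)‖⁻¹ : ℝ) : ℂ) • (v : H), V.smul_mem _ v.2, ?_, fun f hf => ?_⟩
  · rw [norm_smul, Complex.norm_real, norm_inv, norm_norm,
      inv_mul_cancel₀ (norm_ne_zero_iff.mpr hv0')]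
  · rw [inner_smul_right, (Submodule.mem_orthogonal F _).mp hvF f (Submodule.subset_span hf),
      mul_zero]

/-- A sequence of infinite-dimensional subspaces contains an orthonormal sequence of vectors. -/
theorem exists_orthonormal_mem {V : ℕ → Submodule ℂ H} (hV : ∀ n, ¬ FiniteDimensional ℂ (V n)) :
    ∃ e : ℕ → H, Orthonormal ℂ e ∧ ∀ n, e n ∈ V n := by
  classical
  choose g hgV hg1 hg0 using fun n => exists_unit_mem_orthogonal (hV n)
  -- `L n` collects the vectors chosen before stage `n`.
  let L : ℕ → Finset H := fun n => Nat.rec ∅ (fun n L => insert (g n L) L) n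
  have hL : ∀ n, L (n + 1) = insert (g n (L n)) (L n) := fun n => rfl
  have hmono : Monotone L := monotone_nat_of_le_succ fun n => by
    rw [hL]
    exact Finset.subset_insert _ _
  have hmem : ∀ m n, m < n → g m (L m) ∈ L n := fun m n h =>
    hmono (Nat.succ_le_of_lt h) (by rw [hL]; exact Finset.mem_insert_self _ _)
  refine ⟨fun n => g n (L n), ⟨fun n => hg1 n _, fun m n hmn => ?_⟩, fun n => hgV n _⟩
  rcases lt_or_gt_of_ne hmn with h | h
  · exact hg0 n _ _ (hmem m n h)
  · rw [inner_eq_zero_symm]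
    exact hg0 m _ _ (hmem n m h)

/-- The partial isometry that maps one orthonormal sequence to another. -/
theorem exists_hasSum_rankOne [CompleteSpace H] {α β : ℕ → H} (hα : Orthonormal ℂ α)
    (hβ : Orthonormal ℂ β) :
    ∃ X : H →L[ℂ] H, ∀ v, HasSum (fun n => InnerProductSpace.rankOne ℂ (α n) (β n) v) (X v) := by
  classical
  -- `U` and `W` are the isometries from `ℓ²` given by `α` and `β`; the operator sought is `U W*`.
  let U := hα.orthogonalFamily.linearIsometry
  let W := hβ.orthogonalFamily.linearIsometry
  refine ⟨U.toContinuousLinearMap ∘L ContinuousLinearMap.adjoint W.toContinuousLinearMap,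
    fun v => ?_⟩
  have h := hα.orthogonalFamily.hasSum_linearIsometry
    (ContinuousLinearMap.adjoint W.toContinuousLinearMap v)
  refine h.congr_fun fun n => ?_
  have h1 : (ContinuousLinearMap.adjoint W.toContinuousLinearMap v) n = inner ℂ (β n) v := by
    have h2 := lp.inner_single_left (𝕜 := ℂ) n (1 : ℂ)
      (ContinuousLinearMap.adjoint W.toContinuousLinearMap v)
    rw [ContinuousLinearMap.adjoint_inner_right] at h2
    have h3 : W.toContinuousLinearMap (lp.single 2 n (1 : ℂ)) = β n := by
      simp [W]
    rw [h3] at h2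
    simpa using h2.symm
  rw [h1]
  simp

theorem apply_eq_of_hasSum_rankOne {α β : ℕ → H} (hβ : Orthonormal ℂ β) {X : H →L[ℂ] H}
    (hX : ∀ v, HasSum (fun n => InnerProductSpace.rankOne ℂ (α n) (β n) v) (X v)) (n : ℕ) :
    X (β n) = α n := by
  refine (hX (β n)).unique ?_
  have h := hasSum_single (f := fun m => InnerProductSpace.rankOne ℂ (α m) (β m) (β n)) n
    fun m hm => by rw [InnerProductSpace.rankOne_apply, hβ.2 hm, zero_smul]
  rwa [InnerProductSpace.rankOne_apply, inner_self_eq_norm_sq_to_K, hβ.1 n, RCLike.ofReal_one,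
    one_pow, one_smul] at h

end Orthonormal

/-! ### The Hilbert tensor product as an orthogonal sum of copies of `H` -/

section Tensor

variable {H K : Type*}
  [NormedAddCommGroup H] [InnerProductSpace ℂ H]
  [NormedAddCommGroup K] [InnerProductSpace ℂ K]

/-- The map `h ↦ h ⊗ k` into the Hilbert space tensor product. -/
noncomputable def embed (H : Type*) [NormedAddCommGroup H] [InnerProductSpace ℂ H] (k : K) :
    H →L[ℂ] HilbertTensor H K :=
  UniformSpace.Completion.toComplL ∘L (TensorProduct.mkL ℂ H K).flip k

theorem embed_apply (k : K) (h : H) :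
    embed H k h = ((h ⊗ₜ[ℂ] k : H ⊗[ℂ] K) : HilbertTensor H K) := rfl

theorem inner_embed (k k' : K) (h h' : H) :
    (inner ℂ (embed H k h) (embed H k' h') : ℂ) = inner ℂ h h' * inner ℂ k k' := by
  rw [embed_apply, embed_apply, UniformSpace.Completion.inner_coe, TensorProduct.inner_tmul]

theorem tensorOp_embed (A : H →L[ℂ] H) (B : K →L[ℂ] K) (k : K) (h : H) :
    tensorOp A B (embed H k h) = embed H (B k) (A h) := tensorOp_tmul A B h k

theorem ext_embed {F : Type*} [NormedAddCommGroup F] [NormedSpace ℂ F]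
    {A B : HilbertTensor H K →L[ℂ] F} (hAB : ∀ (k : K) (h : H), A (embed H k h) = B (embed H k h)) :
    A = B := by
  refine ContinuousLinearMap.ext fun x => ?_
  refine congrFun (UniformSpace.Completion.ext A.continuous B.continuous fun y => ?_) x
  induction y using TensorProduct.induction_on with
  | zero => rw [UniformSpace.Completion.coe_zero, map_zero, map_zero]
  | tmul h k => exact hAB k h
  | add y z hy hz => rw [UniformSpace.Completion.coe_add, map_add, map_add, hy, hz]

theorem hasSum_embed (ε : HilbertBasis ℕ ℂ K) (k : K) (h : H) :
    HasSum (fun n => ε.repr k n • embed H (ε n) h) (embed H k h) := by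
  have h1 := (ε.hasSum_repr k).mapL (UniformSpace.Completion.toComplL ∘L TensorProduct.mkL ℂ H K h)
  simp only [map_smul] at h1
  exact h1

theorem ext_basis {F : Type*} [NormedAddCommGroup F] [NormedSpace ℂ F] (ε : HilbertBasis ℕ ℂ K)
    {A B : HilbertTensor H K →L[ℂ] F}
    (hAB : ∀ (n : ℕ) (h : H), A (embed H (ε n) h) = B (embed H (ε n) h)) : A = B := by
  refine ext_embed fun k h => ?_
  have h1 := (hasSum_embed ε k h).mapL A
  have h2 := (hasSum_embed ε k h).mapL B
  simp only [map_smul, hAB] at h1 h2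
  exact h1.unique h2

theorem tensorOp_one_embed (A : H →L[ℂ] H) (k : K) (h : H) :
    tensorOp A (1 : K →L[ℂ] K) (embed H k h) = embed H k (A h) := tensorOp_embed A 1 k h

variable [CompleteSpace H]

theorem eq_of_forall_adjoint_embed (ε : HilbertBasis ℕ ℂ K) {v w : HilbertTensor H K}
    (hvw : ∀ n, ContinuousLinearMap.adjoint (embed H (ε n)) v =
      ContinuousLinearMap.adjoint (embed H (ε n)) w) : v = w := by
  have h : innerSL ℂ v = innerSL ℂ w := ext_basis ε fun n h => by
    rw [innerSL_apply_apply, innerSL_apply_apply, ← ContinuousLinearMap.adjoint_inner_left, hvw,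
      ContinuousLinearMap.adjoint_inner_left]
  exact ext_inner_right ℂ fun u => congrArg (fun f => f u) h

theorem adjoint_embed_embed (k k' : K) (h : H) :
    ContinuousLinearMap.adjoint (embed H k) (embed H k' h) = (inner ℂ k k' : ℂ) • h := by
  refine ext_inner_left ℂ fun u => ?_
  rw [ContinuousLinearMap.adjoint_inner_right, inner_embed, inner_smul_right, mul_comm]

theorem adjoint_embed_basis (ε : HilbertBasis ℕ ℂ K) (i j : ℕ) (h : H) :
    ContinuousLinearMap.adjoint (embed H (ε i)) (embed H (ε j) h) = if i = j then h else 0 := by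
  rw [adjoint_embed_embed, orthonormal_iff_ite.mp ε.orthonormal]
  split_ifs <;> simp

theorem star_tensorOp_one (A : H →L[ℂ] H) :
    star (tensorOp A (1 : K →L[ℂ] K)) = tensorOp (star A) 1 := by
  refine ext_embed fun k h => ?_
  have key : innerSL ℂ (star (tensorOp A (1 : K →L[ℂ] K)) (embed H k h)) =
      innerSL ℂ (tensorOp (star A) (1 : K →L[ℂ] K) (embed H k h)) := ext_embed fun k' h' => by
    rw [innerSL_apply_apply, innerSL_apply_apply, ContinuousLinearMap.star_eq_adjoint,
      ContinuousLinearMap.adjoint_inner_left, tensorOp_embed, tensorOp_embed, inner_embed,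
      inner_embed, ContinuousLinearMap.star_eq_adjoint, ContinuousLinearMap.adjoint_inner_left]
    rfl
  exact ext_inner_right ℂ fun u => congrArg (fun f => f u) key

theorem adjoint_embed_tensorOp_one (A : H →L[ℂ] H) (k : K) (v : HilbertTensor H K) :
    ContinuousLinearMap.adjoint (embed H k) (tensorOp A 1 v) =
      A (ContinuousLinearMap.adjoint (embed H k) v) := by
  refine ext_inner_left ℂ fun u => ?_
  have h1 := star_tensorOp_one (K := K) (star A)
  rw [star_star, ContinuousLinearMap.star_eq_adjoint] at h1
  rw [ContinuousLinearMap.adjoint_inner_right, ← h1, ContinuousLinearMap.adjoint_inner_right,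
    tensorOp_one_embed, ContinuousLinearMap.star_eq_adjoint,
    ← ContinuousLinearMap.adjoint_inner_right, ContinuousLinearMap.adjoint_inner_left]

theorem blockProj_eq (ε : HilbertBasis ℕ ℂ K) (i : ℕ) :
    blockProj H ε i = embed H (ε i) ∘L ContinuousLinearMap.adjoint (embed H (ε i)) :=
  ext_embed fun k h => by
    rw [blockProj, tensorOp_embed, ContinuousLinearMap.comp_apply, adjoint_embed_embed,
      InnerProductSpace.rankOne_apply, embed_apply, embed_apply, TensorProduct.tmul_smul,
      TensorProduct.smul_tmul', one_apply_eq_self]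

end Tensor

/-! ### Ampliations, the diagonal seminorm, and closedness of the system space -/

section SystemSpace

variable {H G : Type*}
  [NormedAddCommGroup H] [InnerProductSpace ℂ H] [CompleteSpace H]
  [NormedAddCommGroup G] [InnerProductSpace ℂ G] [CompleteSpace G]

/-- `G` is the orthogonal sum of the ranges of the isometries `J i : H → G`, and `amp A` acts as
`A` on each summand. -/
structure IsAmpliation (J : ℕ → H →L[ℂ] G) (amp : (H →L[ℂ] H) → G →L[ℂ] G) : Prop where
  adjoint_apply : ∀ i j h, ContinuousLinearMap.adjoint (J i) (J j h) = if i = j then h else 0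
  amp_apply : ∀ A i h, amp A (J i h) = J i (A h)
  adjoint_amp : ∀ A i v, ContinuousLinearMap.adjoint (J i) (amp A v) =
    A (ContinuousLinearMap.adjoint (J i) v)
  ext : ∀ v w : G, (∀ n, ContinuousLinearMap.adjoint (J n) v =
    ContinuousLinearMap.adjoint (J n) w) → v = w

/-- The projection onto the range of `J i`. -/
noncomputable def summandProj (J : ℕ → H →L[ℂ] G) (i : ℕ) : G →L[ℂ] G :=
  J i ∘L ContinuousLinearMap.adjoint (J i)

/-- The ampliation of `E((s, t])`. -/
def windowProj (amp : (H →L[ℂ] H) → G →L[ℂ] G) (E : ProjectionValuedMeasure H) (s t : ℝ) :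
    G →L[ℂ] G :=
  amp (E.toFun (window s t))

/-- The ampliation of `E([0, t])`. -/
def ampNestProj (amp : (H →L[ℂ] H) → G →L[ℂ] G) (E : ProjectionValuedMeasure H) (t : ℝ) :
    G →L[ℂ] G :=
  amp (E.toFun {u : I | (u : ℝ) ≤ t})

/-- The operators in the nest algebra whose blocks have vanishing diagonal seminorm almost
everywhere off the given sets. -/
def ampSystemSpace (J : ℕ → H →L[ℂ] G) (amp : (H →L[ℂ] H) → G →L[ℂ] G) (𝒩₀ : Set (H →L[ℂ] H))
    (E : ProjectionValuedMeasure H) (S : ℕ → ℕ → Set I) : Set (G →L[ℂ] G) :=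
  {X | X ∈ nestAlgebra (amp '' 𝒩₀) ∧ ∀ i j, ∀ᵐ x : I, x ∉ S i j →
    diagSeminorm (ampNestProj amp E) x (summandProj J i * X * summandProj J j) = 0}

theorem summandProj_apply (J : ℕ → H →L[ℂ] G) (i : ℕ) (v : G) :
    summandProj J i v = J i (ContinuousLinearMap.adjoint (J i) v) := rfl

theorem star_summandProj (J : ℕ → H →L[ℂ] G) (i : ℕ) :
    star (summandProj J i) = summandProj J i := by
  rw [summandProj, ContinuousLinearMap.star_eq_adjoint, ContinuousLinearMap.adjoint_comp,
    ContinuousLinearMap.adjoint_adjoint]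

theorem norm_mul_mul_le_of_norm_le_one {A : Type*} [NormedRing A] {P Q : A} (hP : ‖P‖ ≤ 1)
    (hQ : ‖Q‖ ≤ 1) (X : A) : ‖P * X * Q‖ ≤ ‖X‖ :=
  calc ‖P * X * Q‖ ≤ ‖P‖ * ‖X‖ * ‖Q‖ :=
        (norm_mul_le _ _).trans (by gcongr; exact norm_mul_le _ _)
    _ ≤ 1 * ‖X‖ * 1 := by gcongr
    _ = ‖X‖ := by ring

namespace IsAmpliation

variable {J : ℕ → H →L[ℂ] G} {amp : (H →L[ℂ] H) → G →L[ℂ] G}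

theorem inner_J (hJ : IsAmpliation J amp) (i j : ℕ) (a b : H) :
    (inner ℂ (J i a) (J j b) : ℂ) = if i = j then inner ℂ a b else 0 := by
  rw [← ContinuousLinearMap.adjoint_inner_right, hJ.adjoint_apply]
  split_ifs <;> simp

theorem norm_J_apply (hJ : IsAmpliation J amp) (i : ℕ) (a : H) : ‖J i a‖ = ‖a‖ := by
  rw [norm_eq_sqrt_re_inner (𝕜 := ℂ), hJ.inner_J, if_pos rfl, ← norm_eq_sqrt_re_inner]

theorem norm_J_le (hJ : IsAmpliation J amp) (i : ℕ) : ‖J i‖ ≤ 1 :=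
  ContinuousLinearMap.opNorm_le_bound _ zero_le_one fun a => by rw [hJ.norm_J_apply, one_mul]

theorem norm_adjoint_J_le (hJ : IsAmpliation J amp) (i : ℕ) :
    ‖ContinuousLinearMap.adjoint (J i)‖ ≤ 1 := by
  rw [ContinuousLinearMap.adjoint.norm_map]
  exact hJ.norm_J_le i

theorem summandProj_J (hJ : IsAmpliation J amp) (i j : ℕ) (h : H) :
    summandProj J i (J j h) = if i = j then J j h else 0 := by
  rw [summandProj_apply, hJ.adjoint_apply]
  split_ifs with hij
  · rw [hij]
  · simp

theorem adjoint_J_summandProj (hJ : IsAmpliation J amp) (i j : ℕ) (v : G) :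
    ContinuousLinearMap.adjoint (J i) (summandProj J j v) =
      if i = j then ContinuousLinearMap.adjoint (J i) v else 0 := by
  rw [summandProj_apply, hJ.adjoint_apply]
  split_ifs with hij
  · rw [hij]
  · rfl

theorem norm_summandProj_le (hJ : IsAmpliation J amp) (i : ℕ) : ‖summandProj J i‖ ≤ 1 :=
  (ContinuousLinearMap.opNorm_comp_le _ _).trans
    (mul_le_one₀ (hJ.norm_J_le i) (norm_nonneg _) (hJ.norm_adjoint_J_le i))

/-- The field `ext` separates vectors by the adjoints of the `J n`, so the comparison is made for
`star A` and `star B`. -/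
theorem ext_op (hJ : IsAmpliation J amp) {A B : G →L[ℂ] G}
    (hAB : ∀ n h, A (J n h) = B (J n h)) : A = B := by
  refine star_injective (ContinuousLinearMap.ext fun v => hJ.ext _ _ fun n => ?_)
  refine ext_inner_left ℂ fun h => ?_
  simp only [ContinuousLinearMap.star_eq_adjoint, ContinuousLinearMap.adjoint_inner_right, hAB]

theorem amp_mul (hJ : IsAmpliation J amp) (A B : H →L[ℂ] H) : amp A * amp B = amp (A * B) :=
  hJ.ext_op fun n h => by simp [hJ.amp_apply]

theorem amp_sub (hJ : IsAmpliation J amp) (A B : H →L[ℂ] H) : amp A - amp B = amp (A - B) :=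
  hJ.ext_op fun n h => by simp [hJ.amp_apply]

theorem star_amp (hJ : IsAmpliation J amp) (A : H →L[ℂ] H) : star (amp A) = amp (star A) := by
  refine hJ.ext_op fun n h => ext_inner_right ℂ fun v => ?_
  rw [hJ.amp_apply, ContinuousLinearMap.star_eq_adjoint, ContinuousLinearMap.adjoint_inner_left,
    ← ContinuousLinearMap.adjoint_inner_right, hJ.adjoint_amp, ContinuousLinearMap.star_eq_adjoint,
    ← ContinuousLinearMap.adjoint_inner_right, ContinuousLinearMap.adjoint_inner_left]

theorem amp_mul_summandProj (hJ : IsAmpliation J amp) (A : H →L[ℂ] H) (i : ℕ) :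
    amp A * summandProj J i = summandProj J i * amp A := by
  refine ContinuousLinearMap.ext fun v => ?_
  simp only [mul_apply_eq_comp, summandProj_apply, hJ.amp_apply, hJ.adjoint_amp]

theorem isStarProjection_amp (hJ : IsAmpliation J amp) {P : H →L[ℂ] H} (hP : IsStarProjection P) :
    IsStarProjection (amp P) where
  isIdempotentElem := by rw [IsIdempotentElem, hJ.amp_mul, hP.isIdempotentElem.eq]
  isSelfAdjoint := by rw [isSelfAdjoint_iff, hJ.star_amp, hP.isSelfAdjoint.star_eq]

theorem isStarProjection_windowProj (hJ : IsAmpliation J amp) (E : ProjectionValuedMeasure H)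
    (s t : ℝ) : IsStarProjection (windowProj amp E s t) :=
  hJ.isStarProjection_amp (E.isStarProjection _ (measurableSet_window s t))

theorem ampNestProj_sub (hJ : IsAmpliation J amp) (E : ProjectionValuedMeasure H) {s t : ℝ}
    (h : s ≤ t) : ampNestProj amp E t - ampNestProj amp E s = windowProj amp E s t := by
  rw [ampNestProj, ampNestProj, hJ.amp_sub, E.coe_le_sub_coe_le h, windowProj]

theorem norm_windowProj_mul_le (hJ : IsAmpliation J amp) (E : ProjectionValuedMeasure H) (s t : ℝ)
    (X : G →L[ℂ] G) :
    ‖windowProj amp E s t * X * windowProj amp E s t‖ ≤ ‖X‖ :=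
  norm_mul_mul_le_of_norm_le_one (hJ.isStarProjection_windowProj E s t).norm_le
    (hJ.isStarProjection_windowProj E s t).norm_le X

theorem norm_windowProj_mul_mono (hJ : IsAmpliation J amp) (E : ProjectionValuedMeasure H)
    {s t s' t' : ℝ}
    (hs : s' ≤ s) (ht : t ≤ t') (X : G →L[ℂ] G) :
    ‖windowProj amp E s t * X * windowProj amp E s t‖ ≤
      ‖windowProj amp E s' t' * X * windowProj amp E s' t'‖ := by
  have hsub := window_subset_window hs ht
  have h1 : windowProj amp E s t * windowProj amp E s' t' = windowProj amp E s t := by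
    rw [windowProj, windowProj, hJ.amp_mul,
      E.mul_eq_left (measurableSet_window _ _) (measurableSet_window _ _) hsub]
  have h2 : windowProj amp E s' t' * windowProj amp E s t = windowProj amp E s t := by
    rw [windowProj, windowProj, hJ.amp_mul,
      E.mul_eq_right (measurableSet_window _ _) (measurableSet_window _ _) hsub]
  refine le_of_eq_of_le ?_ (hJ.norm_windowProj_mul_le E s t _)
  simp only [mul_assoc, h2]
  rw [← mul_assoc (windowProj amp E s t) (windowProj amp E s' t'), h1]

/-- The working form of the seminorm condition: sums, adjoints and norm limits become estimates on a
single small window. -/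
theorem diagSeminorm_eq_zero_iff (hJ : IsAmpliation J amp) (E : ProjectionValuedMeasure H) (x : ℝ)
    (X : G →L[ℂ] G) :
    diagSeminorm (ampNestProj amp E) x X = 0 ↔ ∀ δ > 0, ∃ s t : ℝ, s < x ∧ x < t ∧
      ‖windowProj amp E s t * X * windowProj amp E s t‖ < δ := by
  have hbdd : ∀ r ∈ {r : ℝ | ∃ s t : ℝ, s < x ∧ x < t ∧
      r = ‖(ampNestProj amp E t - ampNestProj amp E s) * X *
        (ampNestProj amp E t - ampNestProj amp E s)‖}, 0 ≤ r := by
    rintro r ⟨s, t, -, -, rfl⟩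
    exact norm_nonneg _
  constructor
  · intro h δ hδ
    have hne : {r : ℝ | ∃ s t : ℝ, s < x ∧ x < t ∧ r = ‖(ampNestProj amp E t -
        ampNestProj amp E s) * X * (ampNestProj amp E t - ampNestProj amp E s)‖}.Nonempty :=
      ⟨_, x - 1, x + 1, by linarith, by linarith, rfl⟩
    obtain ⟨r, ⟨s, t, hs, ht, rfl⟩, hr⟩ := exists_lt_of_csInf_lt hne (h.trans_lt hδ)
    rw [hJ.ampNestProj_sub E (hs.trans ht).le] at hr
    exact ⟨s, t, hs, ht, hr⟩
  · intro h
    refine le_antisymm (le_of_forall_pos_le_add fun δ hδ => ?_) (Real.sInf_nonneg hbdd)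
    obtain ⟨s, t, hs, ht, hst⟩ := h δ hδ
    rw [zero_add]
    refine (csInf_le ⟨0, hbdd⟩ ⟨s, t, hs, ht, rfl⟩).trans ?_
    rw [hJ.ampNestProj_sub E (hs.trans ht).le]
    exact hst.le

theorem diagSeminorm_eq_zero_add (hJ : IsAmpliation J amp)
    (E : ProjectionValuedMeasure H) {x : ℝ}
    {X Y : G →L[ℂ] G}
    (hX : diagSeminorm (ampNestProj amp E) x X = 0)
    (hY : diagSeminorm (ampNestProj amp E) x Y = 0) :
    diagSeminorm (ampNestProj amp E) x (X + Y) = 0 := by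
  rw [hJ.diagSeminorm_eq_zero_iff] at *
  intro δ hδ
  obtain ⟨s, t, hs, ht, h⟩ := hX (δ / 2) (half_pos hδ)
  obtain ⟨s', t', hs', ht', h'⟩ := hY (δ / 2) (half_pos hδ)
  -- On the intersection of the two windows both estimates hold, since compressing further does not
  -- increase norms.
  refine ⟨max s s', min t t', max_lt hs hs', lt_min ht ht', ?_⟩
  have h1 := (hJ.norm_windowProj_mul_mono E (le_max_left s s') (min_le_left t t') X).trans_lt h
  have h2 := (hJ.norm_windowProj_mul_mono E (le_max_right s s') (min_le_right t t') Y).trans_lt h'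
  rw [mul_add, add_mul]
  exact (norm_add_le _ _).trans_lt (by linarith)

theorem diagSeminorm_eq_zero_smul (hJ : IsAmpliation J amp) (E : ProjectionValuedMeasure H)
    {x : ℝ} (c : ℂ)
    {X : G →L[ℂ] G}
    (hX : diagSeminorm (ampNestProj amp E) x X = 0) :
    diagSeminorm (ampNestProj amp E) x (c • X) = 0 := by
  rw [hJ.diagSeminorm_eq_zero_iff] at *
  intro δ hδ
  obtain ⟨s, t, hs, ht, h⟩ := hX (δ / (‖c‖ + 1)) (by positivity)
  refine ⟨s, t, hs, ht, ?_⟩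
  rw [lt_div_iff₀ (by positivity)] at h
  rw [mul_smul_comm, smul_mul_assoc, norm_smul]
  have h0 := norm_nonneg (windowProj amp E s t * X * windowProj amp E s t)
  nlinarith

theorem diagSeminorm_zero (hJ : IsAmpliation J amp) (E : ProjectionValuedMeasure H) (x : ℝ) :
    diagSeminorm (ampNestProj amp E) x (0 : G →L[ℂ] G) = 0 := by
  rw [hJ.diagSeminorm_eq_zero_iff]
  intro δ hδ
  exact ⟨x - 1, x + 1, by linarith, by linarith, by simpa using hδ⟩

theorem diagSeminorm_eq_zero_of_star (hJ : IsAmpliation J amp)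
    (E : ProjectionValuedMeasure H) {x : ℝ}
    {X : G →L[ℂ] G}
    (hX : diagSeminorm (ampNestProj amp E) x (star X) = 0) :
    diagSeminorm (ampNestProj amp E) x X = 0 := by
  rw [hJ.diagSeminorm_eq_zero_iff] at *
  intro δ hδ
  obtain ⟨s, t, hs, ht, h⟩ := hX δ hδ
  refine ⟨s, t, hs, ht, ?_⟩
  rwa [← norm_star, star_mul, star_mul, star_star,
    (hJ.isStarProjection_windowProj E s t).isSelfAdjoint.star_eq, ← mul_assoc] at h

theorem diagSeminorm_eq_zero_of_approx (hJ : IsAmpliation J amp)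
    (E : ProjectionValuedMeasure H) {x : ℝ}
    {X : G →L[ℂ] G}
    (hX : ∀ δ > 0, ∃ Y, ‖X - Y‖ < δ ∧ diagSeminorm (ampNestProj amp E) x Y = 0) :
    diagSeminorm (ampNestProj amp E) x X = 0 := by
  rw [hJ.diagSeminorm_eq_zero_iff]
  intro δ hδ
  obtain ⟨Y, hXY, hY⟩ := hX (δ / 2) (half_pos hδ)
  obtain ⟨s, t, hs, ht, h⟩ := (hJ.diagSeminorm_eq_zero_iff E x Y).mp hY (δ / 2) (half_pos hδ)
  refine ⟨s, t, hs, ht, ?_⟩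
  have h1 := hJ.norm_windowProj_mul_le E s t (X - Y)
  have h2 : windowProj amp E s t * X * windowProj amp E s t =
      windowProj amp E s t * (X - Y) * windowProj amp E s t +
        windowProj amp E s t * Y * windowProj amp E s t := by
    rw [mul_sub, sub_mul, sub_add_cancel]
  rw [h2]
  exact (norm_add_le _ _).trans_lt (by linarith)

variable {E : ProjectionValuedMeasure H} {𝒩₀ : Set (H →L[ℂ] H)}

theorem mem_nestAlgebra_ampliation_iff (hJ : IsAmpliation J amp) (hE : IsSpectralMeasure E 𝒩₀)
    (X : G →L[ℂ] G) :
    X ∈ nestAlgebra (amp '' 𝒩₀) ↔ ∀ t : I, amp (E.toFun (Set.Iic t)) *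
      (X * amp (E.toFun (Set.Iic t))) = X * amp (E.toFun (Set.Iic t)) := by
  have idem : ∀ (t : I) (v : G), amp (E.toFun (Set.Iic t))
      (amp (E.toFun (Set.Iic t)) v) = amp (E.toFun (Set.Iic t)) v := fun t v =>
    congrArg (fun A : G →L[ℂ] G => A v)
      (hJ.isStarProjection_amp (E.isStarProjection _ measurableSet_Iic)).isIdempotentElem
  constructor
  · intro hX t
    refine ContinuousLinearMap.ext fun v => ?_
    obtain ⟨w, hw⟩ := hX (amp (E.toFun (Set.Iic t)))
      ⟨_, by rw [hE.nest_eq]; exact ⟨t, rfl⟩, rfl⟩ _ ⟨v, rfl⟩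
    simp only [mul_apply_eq_comp]
    rw [← hw, idem]
  · intro hX P hP v hv
    obtain ⟨Q, hQ, rfl⟩ := hP
    rw [hE.nest_eq] at hQ
    obtain ⟨t, rfl⟩ := hQ
    obtain ⟨w, rfl⟩ := hv
    exact ⟨_, congrArg (fun A : G →L[ℂ] G => A w) (hX t)⟩

theorem exists_submodule_eq_systemSpace (hJ : IsAmpliation J amp) (hE : IsSpectralMeasure E 𝒩₀)
    (S : ℕ → ℕ → Set I) :
    ∃ V : Submodule ℂ (G →L[ℂ] G),
      (V : Set (G →L[ℂ] G)) = ampSystemSpace J amp 𝒩₀ E S := by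
  refine ⟨{ carrier := ampSystemSpace J amp 𝒩₀ E S, add_mem' := ?_, zero_mem' := ?_,
            smul_mem' := ?_ }, rfl⟩
  · rintro X Y ⟨hX, hX'⟩ ⟨hY, hY'⟩
    refine ⟨?_, fun i j => ?_⟩
    · rw [hJ.mem_nestAlgebra_ampliation_iff hE] at *
      intro t
      rw [add_mul, mul_add, hX t, hY t]
    · filter_upwards [hX' i j, hY' i j] with x h1 h2 hx
      rw [mul_add, add_mul]
      exact hJ.diagSeminorm_eq_zero_add E (h1 hx) (h2 hx)
  · refine ⟨?_, fun i j => Filter.Eventually.of_forall fun x _ => ?_⟩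
    · rw [hJ.mem_nestAlgebra_ampliation_iff hE]
      simp
    · rw [mul_zero, zero_mul]
      exact hJ.diagSeminorm_zero E _
  · rintro c X ⟨hX, hX'⟩
    refine ⟨?_, fun i j => ?_⟩
    · rw [hJ.mem_nestAlgebra_ampliation_iff hE] at *
      intro t
      rw [smul_mul_assoc, mul_smul_comm, hX t]
    · filter_upwards [hX' i j] with x h1 hx
      rw [mul_smul_comm, smul_mul_assoc]
      exact hJ.diagSeminorm_eq_zero_smul E c (h1 hx)

theorem isClosed_systemSpace (hJ : IsAmpliation J amp) (hE : IsSpectralMeasure E 𝒩₀)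
    (S : ℕ → ℕ → Set I) : IsClosed (ampSystemSpace J amp 𝒩₀ E S) := by
  refine IsSeqClosed.isClosed fun X X₀ hX hlim => ⟨?_, fun i j => ?_⟩
  · rw [hJ.mem_nestAlgebra_ampliation_iff hE]
    intro t
    have hc : IsClosed {Y : G →L[ℂ] G |
        amp (E.toFun (Set.Iic t)) * (Y * amp (E.toFun (Set.Iic t))) =
          Y * amp (E.toFun (Set.Iic t))} :=
      isClosed_eq (by fun_prop) (by fun_prop)
    exact hc.mem_of_tendsto hlim (Filter.Eventually.of_forall fun n =>
      (hJ.mem_nestAlgebra_ampliation_iff hE _).mp (hX n).1 t)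
  -- Countably many exceptional null sets combine into one, which is why sequential closedness is
  -- the convenient form.
  · filter_upwards [ae_all_iff.mpr fun n => (hX n).2 i j] with x hx hxS
    refine hJ.diagSeminorm_eq_zero_of_approx E fun δ hδ => ?_
    obtain ⟨n, hn⟩ := ((tendsto_iff_norm_sub_tendsto_zero.mp hlim).eventually
      (gt_mem_nhds hδ)).exists
    refine ⟨_, ?_, hx n hxS⟩
    rw [← sub_mul, ← mul_sub]
    refine (norm_mul_mul_le_of_norm_le_one (hJ.norm_summandProj_le i) (hJ.norm_summandProj_le j)
      _).trans_lt ?_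
    rwa [norm_sub_rev]

end IsAmpliation

end SystemSpace

/-! ### The diagonal of the system space is a masa -/

section Masa

variable {H G : Type*}
  [NormedAddCommGroup H] [InnerProductSpace ℂ H] [CompleteSpace H]
  [NormedAddCommGroup G] [InnerProductSpace ℂ G] [CompleteSpace G]
  {J : ℕ → H →L[ℂ] G} {amp : (H →L[ℂ] H) → G →L[ℂ] G}
  {E : ProjectionValuedMeasure H} {𝒩₀ : Set (H →L[ℂ] H)}

/-- The compression of `X` to a block, as an operator on `H`. -/
noncomputable def block (J : ℕ → H →L[ℂ] G) (X : G →L[ℂ] G) (i j : ℕ) : H →L[ℂ] H :=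
  ContinuousLinearMap.adjoint (J i) ∘L X ∘L J j

theorem block_apply (J : ℕ → H →L[ℂ] G) (X : G →L[ℂ] G) (i j : ℕ) (h : H) :
    block J X i j h = ContinuousLinearMap.adjoint (J i) (X (J j h)) := rfl

/-- The ampliated nest together with the projections onto the summands. -/
def masaGenerators (J : ℕ → H →L[ℂ] G) (amp : (H →L[ℂ] H) → G →L[ℂ] G)
    (E : ProjectionValuedMeasure H) : Set (G →L[ℂ] G) :=
  (Set.range fun t : I => amp (E.toFun (Set.Iic t))) ∪ Set.range (summandProj J)

namespace IsAmpliation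

theorem block_comm (hJ : IsAmpliation J amp) {X : G →L[ℂ] G} {A : H →L[ℂ] H}
    (hX : amp A * X = X * amp A) (i j : ℕ) : A * block J X i j = block J X i j * A := by
  refine ContinuousLinearMap.ext fun h => ?_
  simp only [mul_apply_eq_comp, block_apply]
  rw [← hJ.adjoint_amp, ← hJ.amp_apply]
  exact congrArg (fun B : G →L[ℂ] G => ContinuousLinearMap.adjoint (J i) (B (J j h))) hX

/-- Transfers smallness from `G` to `H`, where the localization result for the spectral measure
applies. -/
theorem norm_window_block_le (hJ : IsAmpliation J amp) (X : G →L[ℂ] G) (i j : ℕ) (s t : ℝ) :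
    ‖E.toFun (window s t) * block J X i j * E.toFun (window s t)‖ ≤
      ‖windowProj amp E s t * (summandProj J i * X * summandProj J j) * windowProj amp E s t‖ := by
  have h : E.toFun (window s t) * block J X i j * E.toFun (window s t) =
      ContinuousLinearMap.adjoint (J i) ∘L (windowProj amp E s t *
        (summandProj J i * X * summandProj J j) * windowProj amp E s t) ∘L J j := by
    refine ContinuousLinearMap.ext fun h => ?_
    simp only [mul_apply_eq_comp, block_apply, ContinuousLinearMap.comp_apply, windowProj,
      hJ.adjoint_amp, hJ.amp_apply, hJ.summandProj_J, hJ.adjoint_J_summandProj, if_true]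
  rw [h]
  calc _ ≤ ‖ContinuousLinearMap.adjoint (J i)‖ * (‖windowProj amp E s t *
        (summandProj J i * X * summandProj J j) * windowProj amp E s t‖ * ‖J j‖) :=
        (ContinuousLinearMap.opNorm_comp_le _ _).trans (by
          gcongr; exact ContinuousLinearMap.opNorm_comp_le _ _)
    _ ≤ 1 * (‖windowProj amp E s t *
        (summandProj J i * X * summandProj J j) * windowProj amp E s t‖ * 1) := by
        gcongr
        exacts [hJ.norm_adjoint_J_le i, hJ.norm_J_le j]
    _ = _ := by ring

theorem mem_masa_iff (hJ : IsAmpliation J amp) (X : G →L[ℂ] G) :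
    X ∈ StarSubalgebra.centralizer ℂ (masaGenerators J amp E) ↔
      (∀ t : I, amp (E.toFun (Set.Iic t)) * X = X * amp (E.toFun (Set.Iic t))) ∧
      ∀ i, summandProj J i * X = X * summandProj J i := by
  have sa : ∀ g ∈ masaGenerators J amp E, star g = g := by
    rintro _ (⟨t, rfl⟩ | ⟨i, rfl⟩)
    · exact (hJ.isStarProjection_amp (E.isStarProjection _ measurableSet_Iic)).isSelfAdjoint
    · exact star_summandProj J i
  rw [StarSubalgebra.mem_centralizer_iff]
  constructor
  · exact fun h => ⟨fun t => (h _ (Or.inl ⟨t, rfl⟩)).1, fun i => (h _ (Or.inr ⟨i, rfl⟩)).1⟩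
  · rintro ⟨h1, h2⟩ g hg
    rw [sa g hg, and_self]
    rcases hg with ⟨t, rfl⟩ | ⟨i, rfl⟩
    · exact h1 t
    · exact h2 i

/-- For a nest projection `P`, invariance gives `P X P = X P`, and the adjoint of the same identity
for `star X` gives `P X P = P X`. -/
theorem amp_commute_of_mem_of_star_mem (hJ : IsAmpliation J amp) (hE : IsSpectralMeasure E 𝒩₀)
    {X : G →L[ℂ] G} (hX : X ∈ nestAlgebra (amp '' 𝒩₀)) (hX' : star X ∈ nestAlgebra (amp '' 𝒩₀))
    (t : I) : amp (E.toFun (Set.Iic t)) * X = X * amp (E.toFun (Set.Iic t)) := by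
  rw [hJ.mem_nestAlgebra_ampliation_iff hE] at hX hX'
  have h1 := hX t
  have h2 := congrArg star (hX' t)
  rw [star_mul, star_mul, star_star, (hJ.isStarProjection_amp
    (E.isStarProjection _ measurableSet_Iic)).isSelfAdjoint.star_eq, mul_assoc, h1] at h2
  exact h2.symm

theorem block_eq_zero (hJ : IsAmpliation J amp) (hE : IsSpectralMeasure E 𝒩₀)
    {S : ℕ → ℕ → Set I} (hS : IsTriangularSystem S) {X : G →L[ℂ] G}
    (hX : X ∈ ampSystemSpace J amp 𝒩₀ E S) (hX' : star X ∈ ampSystemSpace J amp 𝒩₀ E S)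
    {i j : ℕ} (hij : i ≠ j) : block J X i j = 0 := by
  refine hE.eq_zero_of_ae_locally_small
    (fun t => hJ.block_comm (hJ.amp_commute_of_mem_of_star_mem hE hX.1 hX'.1 t) i j) ?_
  filter_upwards [hX.2 i j, hX'.2 j i] with x h1 h2 δ hδ
  have h0 : diagSeminorm (ampNestProj amp E) x (summandProj J i * X * summandProj J j) = 0 := by
    -- Antisymmetry of the system: inside `S i j` the condition on the `(j, i)` block of `star X`
    -- takes over.
    by_cases hx : x ∈ S i j
    · have hx' : x ∉ S j i := fun h => by
        have : x ∈ S i j ∩ S j i := ⟨hx, h⟩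
        rw [hS.antisymm i j hij] at this
        exact this
      refine hJ.diagSeminorm_eq_zero_of_star E ?_
      rw [star_mul, star_mul, star_summandProj, star_summandProj, ← mul_assoc]
      exact h2 hx'
    · exact h1 hx
  obtain ⟨s, t, hs, ht, h⟩ := (hJ.diagSeminorm_eq_zero_iff E _ _).mp h0 δ hδ
  exact ⟨s, t, hs, ht, (hJ.norm_window_block_le X i j s t).trans_lt h⟩

/-- An operator in the commutant has no off-diagonal blocks, and `S i i = [0, 1]` puts no condition
on the diagonal ones. Conversely, the off-diagonal blocks vanish by `block_eq_zero`. -/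
theorem inter_star_eq_masa (hJ : IsAmpliation J amp) (hE : IsSpectralMeasure E 𝒩₀)
    {S : ℕ → ℕ → Set I} (hS : IsTriangularSystem S) :
    (StarSubalgebra.centralizer ℂ (masaGenerators J amp E) : Set (G →L[ℂ] G)) =
      ampSystemSpace J amp 𝒩₀ E S ∩ {X | star X ∈ ampSystemSpace J amp 𝒩₀ E S} := by
  have sub : ∀ X ∈ StarSubalgebra.centralizer ℂ (masaGenerators J amp E),
      X ∈ ampSystemSpace J amp 𝒩₀ E S := by
    intro X hX
    obtain ⟨h1, h2⟩ := (hJ.mem_masa_iff X).mp hX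
    refine ⟨?_, fun i j => ?_⟩
    · rw [hJ.mem_nestAlgebra_ampliation_iff hE]
      intro t
      rw [← h1 t, ← mul_assoc, (hJ.isStarProjection_amp
        (E.isStarProjection _ measurableSet_Iic)).isIdempotentElem.eq]
    · refine Filter.Eventually.of_forall fun x hx => ?_
      have hij : i ≠ j := by
        rintro rfl
        rw [hS.refl i] at hx
        exact hx trivial
      have h0 : summandProj J i * X * summandProj J j = 0 := by
        refine ContinuousLinearMap.ext fun v => ?_
        rw [h2 i]
        simp [summandProj_apply, hJ.adjoint_apply, hij]
      rw [h0]
      exact hJ.diagSeminorm_zero E x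
  ext X
  constructor
  · exact fun hX => ⟨sub X hX, sub (star X) (star_mem hX)⟩
  · rintro ⟨hX, hX'⟩
    refine (hJ.mem_masa_iff X).mpr
      ⟨hJ.amp_commute_of_mem_of_star_mem hE hX.1 hX'.1, fun i => ?_⟩
    refine hJ.ext_op fun n h => hJ.ext _ _ fun m => ?_
    simp only [mul_apply_eq_comp, hJ.adjoint_J_summandProj, hJ.summandProj_J]
    by_cases hmn : m = n
    · subst hmn
      by_cases hmi : m = i
      · subst hmi
        simp
      · simp [hmi, Ne.symm hmi]
    · have h0 : ContinuousLinearMap.adjoint (J m) (X (J n h)) = 0 := by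
        rw [← block_apply, hJ.block_eq_zero hE hS hX hX' hmn]
        rfl
      split_ifs <;> simp [h0]

theorem mul_comm_of_mem_masa (hJ : IsAmpliation J amp) (hE : IsSpectralMeasure E 𝒩₀)
    (hmult : IsMultiplicityFree 𝒩₀) {X Y : G →L[ℂ] G}
    (hX : X ∈ StarSubalgebra.centralizer ℂ (masaGenerators J amp E))
    (hY : Y ∈ StarSubalgebra.centralizer ℂ (masaGenerators J amp E)) : X * Y = Y * X := by
  obtain ⟨ξ, hξ, -⟩ := hmult
  have hcen : ∀ {X : G →L[ℂ] G}, X ∈ StarSubalgebra.centralizer ℂ (masaGenerators J amp E) →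
      ∀ n, block J X n n ∈ Set.centralizer 𝒩₀ := by
    intro X hX n P hP
    rw [hE.nest_eq] at hP
    obtain ⟨t, rfl⟩ := hP
    exact hJ.block_comm (((hJ.mem_masa_iff X).mp hX).1 t) n n
  have happ : ∀ {X : G →L[ℂ] G}, X ∈ StarSubalgebra.centralizer ℂ (masaGenerators J amp E) →
      ∀ n h, X (J n h) = J n (block J X n n h) := by
    intro X hX n h
    have h1 := congrArg (fun A : G →L[ℂ] G => A (J n h)) (((hJ.mem_masa_iff X).mp hX).2 n)
    simp only [mul_apply_eq_comp, hJ.summandProj_J, if_true] at h1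
    rw [← h1, summandProj_apply, block_apply]
  have hblock := fun n => mul_comm_of_mem_centralizer (𝒩 := 𝒩₀)
    (fun P hP => by
      rw [hE.nest_eq] at hP
      obtain ⟨t, rfl⟩ := hP
      exact (E.isStarProjection _ measurableSet_Iic).isSelfAdjoint)
    (fun P hP Q hQ => by
      rw [hE.nest_eq] at hP hQ
      obtain ⟨s, rfl⟩ := hP
      obtain ⟨t, rfl⟩ := hQ
      change E.toFun _ * E.toFun _ = E.toFun _ * E.toFun _
      rw [← E.inter _ _ measurableSet_Iic measurableSet_Iic, Set.inter_comm,
        E.inter _ _ measurableSet_Iic measurableSet_Iic])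
    hξ (hcen hX n) (hcen hY n)
  refine hJ.ext_op fun n h => ?_
  simp only [mul_apply_eq_comp, happ hX, happ hY]
  exact congrArg (fun A : H →L[ℂ] H => J n (A h)) (hblock n)

theorem masaGenerators_subset (hJ : IsAmpliation J amp) :
    masaGenerators J amp E ⊆ StarSubalgebra.centralizer ℂ (masaGenerators J amp E) := by
  rintro _ (⟨s, rfl⟩ | ⟨j, rfl⟩)
  · refine (hJ.mem_masa_iff _).mpr ⟨fun t => ?_, fun i => (hJ.amp_mul_summandProj _ i).symm⟩
    change amp _ * amp _ = amp _ * amp _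
    rw [hJ.amp_mul, hJ.amp_mul, ← E.inter _ _ measurableSet_Iic measurableSet_Iic,
      Set.inter_comm, E.inter _ _ measurableSet_Iic measurableSet_Iic]
  · refine (hJ.mem_masa_iff _).mpr ⟨fun t => hJ.amp_mul_summandProj _ j, fun i => ?_⟩
    refine hJ.ext_op fun n h => ?_
    simp only [mul_apply_eq_comp, hJ.summandProj_J]
    split_ifs <;> simp_all [hJ.summandProj_J]

/-- Maximality: the generators lie in their own commutant, so a commutative algebra containing this
commutant commutes with the generators and is contained in it. -/
theorem isTriangularSpace (hJ : IsAmpliation J amp) (hE : IsSpectralMeasure E 𝒩₀)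
    (hmult : IsMultiplicityFree 𝒩₀) {S : ℕ → ℕ → Set I} (hS : IsTriangularSystem S) :
    IsTriangularSpace (ampSystemSpace J amp 𝒩₀ E S) := by
  refine ⟨hJ.exists_submodule_eq_systemSpace hE S,
    StarSubalgebra.centralizer ℂ (masaGenerators J amp E), hJ.inter_star_eq_masa hE hS,
    fun X hX Y hY => hJ.mul_comm_of_mem_masa hE hmult hX hY, fun B hB hle X hX => ?_⟩
  exact (hJ.mem_masa_iff X).mpr
    ⟨fun t => hB _ (hle (hJ.masaGenerators_subset (Or.inl ⟨t, rfl⟩))) _ hX,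
      fun i => hB _ (hle (hJ.masaGenerators_subset (Or.inr ⟨i, rfl⟩))) _ hX⟩

end IsAmpliation

end Masa

/-! ### Factorizations showing that products leave the system space -/

section Products

variable {H G : Type*}
  [NormedAddCommGroup H] [InnerProductSpace ℂ H] [CompleteSpace H]
  [NormedAddCommGroup G] [InnerProductSpace ℂ G] [CompleteSpace G]
  {J : ℕ → H →L[ℂ] G} {amp : (H →L[ℂ] H) → G →L[ℂ] G}
  {E : ProjectionValuedMeasure H} {𝒩₀ : Set (H →L[ℂ] H)}

theorem exists_seq_dense_intervals : ∃ p q : ℕ → ℝ, (∀ n, 0 ≤ p n ∧ p n < q n ∧ q n ≤ 1) ∧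
    ∀ (x : I) (s t : ℝ), s < x → x < t → ∃ n, s ≤ p n ∧ q n ≤ t := by
  have : Nonempty {r : ℚ × ℚ // (0 : ℝ) ≤ r.1 ∧ (r.1 : ℝ) < r.2 ∧ (r.2 : ℝ) ≤ 1} :=
    ⟨⟨(0, 1), by norm_num⟩⟩
  obtain ⟨e, he⟩ :=
    exists_surjective_nat {r : ℚ × ℚ // (0 : ℝ) ≤ r.1 ∧ (r.1 : ℝ) < r.2 ∧ (r.2 : ℝ) ≤ 1}
  refine ⟨fun n => (e n).1.1, fun n => (e n).1.2, fun n => (e n).2, fun x s t hs ht => ?_⟩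
  have h0 : (0 : ℝ) ≤ x := x.2.1
  have h1 : (x : ℝ) ≤ 1 := x.2.2
  -- Windows around the end points reach outside `[0, 1]` and are clipped before a rational interval
  -- is chosen.
  have hlt : max s 0 < min t 1 := max_lt (lt_min (by linarith) (by linarith))
    (lt_min (by linarith) one_pos)
  obtain ⟨a, ha1, ha2⟩ := exists_rat_btwn hlt
  obtain ⟨b, hb1, hb2⟩ := exists_rat_btwn ha2
  obtain ⟨n, hn⟩ := he ⟨(a, b), ((le_max_right s 0).trans_lt ha1).le, hb1,
    (hb2.trans_le (min_le_right t 1)).le⟩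
  refine ⟨n, ?_, ?_⟩
  · simp only [hn]
    exact ((le_max_left s 0).trans_lt ha1).le
  · simp only [hn]
    exact (hb2.trans_le (min_le_left t 1)).le

theorem ProjectionValuedMeasure.apply_of_mem_range_of_subset (E : ProjectionValuedMeasure H)
    {S T : Set I} (hS : MeasurableSet S) (hT : MeasurableSet T) (h : S ⊆ T) {a : H}
    (ha : a ∈ (E.toFun S).range) : E.toFun T a = a := by
  obtain ⟨b, rfl⟩ := ha
  exact congrArg (fun A : H →L[ℂ] H => A b) (E.mul_eq_right hS hT h)

theorem ProjectionValuedMeasure.apply_of_mem_range_of_disjoint (E : ProjectionValuedMeasure H)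
    {S T : Set I} (hS : MeasurableSet S) (hT : MeasurableSet T) (h : Disjoint T S) {a : H}
    (ha : a ∈ (E.toFun S).range) : E.toFun T a = 0 := by
  obtain ⟨b, rfl⟩ := ha
  exact congrArg (fun A : H →L[ℂ] H => A b) (E.mul_eq_zero hT hS h)

/-- The case split is at the common end point `s`. This is the order condition that puts the
rank-one operator from `b` to `a` into the nest algebra. -/
theorem ProjectionValuedMeasure.Iic_apply_eq_or (E : ProjectionValuedMeasure H) {r s u : ℝ}
    {a b : H} (ha : a ∈ (E.toFun (window r s)).range) (hb : b ∈ (E.toFun (window s u)).range)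
    (t : I) : E.toFun (Set.Iic t) a = a ∨ E.toFun (Set.Iic t) b = 0 := by
  rcases le_or_gt s (t : ℝ) with h | h
  · refine Or.inl (E.apply_of_mem_range_of_subset (measurableSet_window _ _) measurableSet_Iic
      (fun v hv => ?_) ha)
    exact Subtype.coe_le_coe.mp (hv.2.trans h)
  · refine Or.inr (E.apply_of_mem_range_of_disjoint (measurableSet_window _ _) measurableSet_Iic
      (Set.disjoint_left.mpr fun v hv hv' => ?_) hb)
    have : (v : ℝ) ≤ t := hv
    linarith [hv'.1]

namespace IsAmpliation

theorem inner_summandProj (i : ℕ) (v w : G) :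
    (inner ℂ v (summandProj J i w) : ℂ) = inner ℂ (summandProj J i v) w := by
  conv_rhs => rw [← star_summandProj, ContinuousLinearMap.star_eq_adjoint,
    ContinuousLinearMap.adjoint_inner_left]

theorem orthonormal_same (hJ : IsAmpliation J amp) (i : ℕ) {a : ℕ → H} (ha : Orthonormal ℂ a) :
    Orthonormal ℂ fun n => J i (a n) :=
  ⟨fun n => by rw [hJ.norm_J_apply, ha.1 n], fun m n hmn => by
    change (inner ℂ (J i (a m)) (J i (a n)) : ℂ) = 0
    rw [hJ.inner_J, if_pos rfl]
    exact ha.2 hmn⟩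

theorem orthonormal_distinct (hJ : IsAmpliation J amp) {b : ℕ → H} (hb : ∀ n, ‖b n‖ = 1) :
    Orthonormal ℂ fun n => J n (b n) :=
  ⟨fun n => by rw [hJ.norm_J_apply, hb n], fun m n hmn => by
    change (inner ℂ (J m (b m)) (J n (b n)) : ℂ) = 0
    rw [hJ.inner_J, if_neg hmn]⟩

/-- Compressing the range vector alone suffices: its spectral projections on windows shrinking to
`x` tend to `0`, since points are null. -/
theorem diagSeminorm_rankOne (hJ : IsAmpliation J amp) (hE : IsSpectralMeasure E 𝒩₀) (x : I)
    (i : ℕ) (a : H) (w : G) :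
    diagSeminorm (ampNestProj amp E) x (InnerProductSpace.rankOne ℂ (J i a) w) = 0 := by
  rw [hJ.diagSeminorm_eq_zero_iff]
  intro δ hδ
  obtain ⟨s, t, hs, ht, h⟩ := hE.exists_window_norm_lt x a (δ := δ / (‖w‖ + 1)) (by positivity)
  refine ⟨s, t, hs, ht, ?_⟩
  have h1 : windowProj amp E s t * InnerProductSpace.rankOne ℂ (J i a) w =
      InnerProductSpace.rankOne ℂ (J i (E.toFun (window s t) a)) w := by
    rw [← hJ.amp_apply]
    exact InnerProductSpace.comp_rankOne _ _ _
  rw [h1]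
  refine (norm_mul_le _ _).trans_lt ?_
  rw [InnerProductSpace.norm_rankOne, hJ.norm_J_apply]
  rw [lt_div_iff₀ (by positivity)] at h
  have h2 := (hJ.isStarProjection_windowProj E s t).norm_le
  have h3 := norm_nonneg (E.toFun (window s t) a)
  have h4 := norm_nonneg w
  calc _ ≤ ‖E.toFun (window s t) a‖ * ‖w‖ * 1 := by gcongr
    _ < δ := by nlinarith

/-- With `P` a nest projection, `P X P = X P` holds term by term: either `P` fixes `α n` or the term
annihilates the range of `P`. -/
theorem mem_nestAlgebra_of_hasSum (hJ : IsAmpliation J amp) (hE : IsSpectralMeasure E 𝒩₀)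
    {α β : ℕ → G} {X : G →L[ℂ] G}
    (hX : ∀ v, HasSum (fun n => InnerProductSpace.rankOne ℂ (α n) (β n) v) (X v))
    (hαβ : ∀ n (t : I), amp (E.toFun (Set.Iic t)) (α n) = α n ∨
      amp (E.toFun (Set.Iic t)) (β n) = 0) : X ∈ nestAlgebra (amp '' 𝒩₀) := by
  rw [hJ.mem_nestAlgebra_ampliation_iff hE]
  intro t
  refine ContinuousLinearMap.ext fun v => ?_
  have h1 := hX (amp (E.toFun (Set.Iic t)) v)
  refine (h1.mapL (amp (E.toFun (Set.Iic t)))).unique (h1.congr_fun fun n => ?_)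
  rw [InnerProductSpace.rankOne_apply, map_smul]
  rcases hαβ n t with h | h
  · rw [h]
  · have h0 : (inner ℂ (β n) (amp (E.toFun (Set.Iic t)) v) : ℂ) = 0 := by
      rw [← (hJ.isStarProjection_amp (E.isStarProjection (Set.Iic t)
        measurableSet_Iic)).isSelfAdjoint.star_eq, ContinuousLinearMap.star_eq_adjoint,
        ContinuousLinearMap.adjoint_inner_right, h, inner_zero_left]
    rw [h0, zero_smul, zero_smul]

/-- A sum of rank-one operators in the nest algebra, with sources in distinct summands and ranges in
one summand, has vanishing diagonal seminorms. -/
theorem mem_of_distinct_sources (hJ : IsAmpliation J amp) (hE : IsSpectralMeasure E 𝒩₀)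
    (S : ℕ → ℕ → Set I) (i : ℕ) {a b : ℕ → H} {X : G →L[ℂ] G}
    (hX : ∀ v, HasSum (fun n => InnerProductSpace.rankOne ℂ (J i (a n)) (J n (b n)) v) (X v))
    (hab : ∀ n (t : I), E.toFun (Set.Iic t) (a n) = a n ∨ E.toFun (Set.Iic t) (b n) = 0) :
    X ∈ ampSystemSpace J amp 𝒩₀ E S := by
  refine ⟨hJ.mem_nestAlgebra_of_hasSum hE hX fun n t => ?_, fun k l =>
    Filter.Eventually.of_forall fun x _ => ?_⟩
  · rw [hJ.amp_apply, hJ.amp_apply]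
    rcases hab n t with h | h
    · exact Or.inl (by rw [h])
    · exact Or.inr (by rw [h, map_zero])
  -- Only the term with source in summand `l` survives, so the block is rank one or zero.
  · have h0 : summandProj J k * X * summandProj J l =
        InnerProductSpace.rankOne ℂ (J i (if k = i then a l else 0)) (J l (b l)) := by
      refine ContinuousLinearMap.ext fun v => ?_
      have h1 := (hX (summandProj J l v)).mapL (summandProj J k)
      refine h1.unique ?_
      convert hasSum_single (f := fun n => summandProj J k (InnerProductSpace.rankOne ℂ
        (J i (a n)) (J n (b n)) (summandProj J l v))) l fun n hn => ?_ using 1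
      · rw [InnerProductSpace.rankOne_apply, InnerProductSpace.rankOne_apply, inner_summandProj,
          hJ.summandProj_J, if_pos rfl, map_smul, hJ.summandProj_J]
        split_ifs <;> simp
      · rw [InnerProductSpace.rankOne_apply, inner_summandProj, hJ.summandProj_J,
          if_neg (Ne.symm hn), inner_zero_left, zero_smul, map_zero]
    rw [h0]
    exact hJ.diagSeminorm_rankOne hE x _ _ _

/-- A sum of rank-one operators in the nest algebra, with ranges in distinct summands, has
vanishing diagonal seminorms. -/
theorem mem_of_distinct_ranges (hJ : IsAmpliation J amp) (hE : IsSpectralMeasure E 𝒩₀)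
    (S : ℕ → ℕ → Set I) (j : ℕ) {b c : ℕ → H} {Y : G →L[ℂ] G}
    (hY : ∀ v, HasSum (fun n => InnerProductSpace.rankOne ℂ (J n (b n)) (J j (c n)) v) (Y v))
    (hbc : ∀ n (t : I), E.toFun (Set.Iic t) (b n) = b n ∨ E.toFun (Set.Iic t) (c n) = 0) :
    Y ∈ ampSystemSpace J amp 𝒩₀ E S := by
  refine ⟨hJ.mem_nestAlgebra_of_hasSum hE hY fun n t => ?_, fun k l =>
    Filter.Eventually.of_forall fun x _ => ?_⟩
  · rw [hJ.amp_apply, hJ.amp_apply]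
    rcases hbc n t with h | h
    · exact Or.inl (by rw [h])
    · exact Or.inr (by rw [h, map_zero])
  · have h0 : summandProj J k * Y * summandProj J l =
        InnerProductSpace.rankOne ℂ (J k (b k)) (summandProj J l (J j (c k))) := by
      refine ContinuousLinearMap.ext fun v => ?_
      have h1 := (hY (summandProj J l v)).mapL (summandProj J k)
      refine h1.unique ?_
      convert hasSum_single (f := fun n => summandProj J k (InnerProductSpace.rankOne ℂ
        (J n (b n)) (J j (c n)) (summandProj J l v))) k fun n hn => ?_ using 1
      · rw [InnerProductSpace.rankOne_apply, InnerProductSpace.rankOne_apply, inner_summandProj,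
          map_smul, hJ.summandProj_J k k, if_pos rfl]
      · rw [InnerProductSpace.rankOne_apply, map_smul, hJ.summandProj_J, if_neg (Ne.symm hn),
          smul_zero]
    rw [h0]
    exact hJ.diagSeminorm_rankOne hE x _ _ _

/-- The intermediate vectors are spread over all summands, so no block of `X` or `Y` sees more than
one term, while the product gathers all terms in the block `(i, j)`. -/
theorem exists_factors (hJ : IsAmpliation J amp) (hE : IsSpectralMeasure E 𝒩₀)
    (S : ℕ → ℕ → Set I) (i j : ℕ) :
    ∃ X ∈ ampSystemSpace J amp 𝒩₀ E S, ∃ Y ∈ ampSystemSpace J amp 𝒩₀ E S,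
      summandProj J i * X = X ∧ Y * summandProj J j = Y ∧
      (∃ α β γ : ℕ → G, Orthonormal ℂ α ∧ Orthonormal ℂ β ∧ Orthonormal ℂ γ ∧
        (∀ v, HasSum (fun n => InnerProductSpace.rankOne ℂ (α n) (β n) v) (X v)) ∧
        (∀ v, HasSum (fun n => InnerProductSpace.rankOne ℂ (β n) (γ n) v) (Y v))) ∧
      ∀ x : I, 1 ≤ diagSeminorm (ampNestProj amp E) x
        (summandProj J i * (X * Y) * summandProj J j) := by
  obtain ⟨p, q, hpq, hdense⟩ := exists_seq_dense_intervals
  -- The three thirds, from left to right, carry `a n`, `b n` and `c n`. Different intervals may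
  -- overlap, so orthonormality of `a` and of `c` needs the inductive choice; the vectors `b n` are
  -- separated by their summands.
  let d : ℕ → ℝ := fun n => (q n - p n) / 3
  have hd : ∀ n, 0 < d n := fun n => by
    have := (hpq n).2.1
    simp only [d]
    linarith
  have hq : ∀ n, q n = p n + 3 * d n := fun n => by
    simp only [d]
    ring
  obtain ⟨a, ha, haV⟩ := exists_orthonormal_mem fun n => hE.not_finiteDimensional_range_window
    (s := p n) (t := p n + d n) (hpq n).1 (by linarith [hd n])
    (by linarith [hd n, (hpq n).2.2, hq n])
  obtain ⟨b, hb, hbV⟩ := exists_orthonormal_mem fun n => hE.not_finiteDimensional_range_window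
    (s := p n + d n) (t := p n + 2 * d n) (by linarith [(hpq n).1, hd n]) (by linarith [hd n])
    (by linarith [hd n, (hpq n).2.2, hq n])
  obtain ⟨c, hc, hcV⟩ := exists_orthonormal_mem fun n => hE.not_finiteDimensional_range_window
    (s := p n + 2 * d n) (t := q n) (by linarith [(hpq n).1, hd n]) (by linarith [hd n, hq n])
    (hpq n).2.2
  have hα := hJ.orthonormal_same i ha
  have hβ := hJ.orthonormal_distinct hb.1
  have hγ := hJ.orthonormal_same j hc
  obtain ⟨X, hX⟩ := exists_hasSum_rankOne hα hβ
  obtain ⟨Y, hY⟩ := exists_hasSum_rankOne hβ hγ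
  refine ⟨X, hJ.mem_of_distinct_sources hE S i hX fun n => E.Iic_apply_eq_or (haV n) (hbV n),
    Y, hJ.mem_of_distinct_ranges hE S j hY fun n => E.Iic_apply_eq_or (hbV n) (hcV n),
    ?_, ?_, ⟨_, _, _, hα, hβ, hγ, hX, hY⟩, fun x => ?_⟩
  · refine ContinuousLinearMap.ext fun v => ((hX v).mapL (summandProj J i)).unique
      ((hX v).congr_fun fun n => ?_)
    rw [InnerProductSpace.rankOne_apply, map_smul, hJ.summandProj_J, if_pos rfl]
  · refine ContinuousLinearMap.ext fun v => (hY (summandProj J j v)).unique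
      ((hY v).congr_fun fun n => ?_)
    rw [InnerProductSpace.rankOne_apply, InnerProductSpace.rankOne_apply, inner_summandProj,
      hJ.summandProj_J, if_pos rfl]
  · refine le_csInf ⟨_, x - 1, x + 1, by linarith, by linarith, rfl⟩ ?_
    rintro _ ⟨s, t, hs, ht, rfl⟩
    rw [hJ.ampNestProj_sub E (hs.trans ht).le]
    obtain ⟨n, hsn, hnt⟩ := hdense x s t hs ht
    have hwa : windowProj amp E s t (J i (a n)) = J i (a n) := by
      rw [windowProj, hJ.amp_apply, E.apply_of_mem_range_of_subset (measurableSet_window _ _)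
        (measurableSet_window _ _) (window_subset_window hsn (by linarith [hd n, hq n])) (haV n)]
    have hwc : windowProj amp E s t (J j (c n)) = J j (c n) := by
      rw [windowProj, hJ.amp_apply, E.apply_of_mem_range_of_subset (measurableSet_window _ _)
        (measurableSet_window _ _) (window_subset_window (by linarith [hd n]) hnt) (hcV n)]
    -- The window contains the whole `n`-th interval, so the compression still maps the unit vector
    -- `J j (c n)` to the unit vector `J i (a n)`.
    have hval : (windowProj amp E s t * (summandProj J i * (X * Y) * summandProj J j) *
        windowProj amp E s t) (J j (c n)) = J i (a n) := by
      simp only [mul_apply_eq_comp]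
      rw [hwc, hJ.summandProj_J, if_pos rfl, apply_eq_of_hasSum_rankOne hγ hY n,
        apply_eq_of_hasSum_rankOne hβ hX n, hJ.summandProj_J, if_pos rfl, hwa]
    have hle := ContinuousLinearMap.le_opNorm (windowProj amp E s t *
      (summandProj J i * (X * Y) * summandProj J j) * windowProj amp E s t) (J j (c n))
    rwa [hval, hα.1 n, hγ.1 n, mul_one] at hle

/-- Closure under products would force every `S i j` to have full measure, but `S 0 1` and `S 1 0`
are disjoint. -/
theorem not_mul_mem (hJ : IsAmpliation J amp) (hE : IsSpectralMeasure E 𝒩₀)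
    {S : ℕ → ℕ → Set I} (hS : IsTriangularSystem S) :
    ¬ ∀ X ∈ ampSystemSpace J amp 𝒩₀ E S, ∀ Y ∈ ampSystemSpace J amp 𝒩₀ E S,
      X * Y ∈ ampSystemSpace J amp 𝒩₀ E S := by
  intro hmul
  have hfull : ∀ i j, ∀ᵐ x : I, x ∈ S i j := by
    intro i j
    obtain ⟨X, hX, Y, hY, -, -, -, hXY⟩ := hJ.exists_factors hE S i j
    filter_upwards [(hmul X hX Y hY).2 i j] with x hx
    by_contra hxS
    have := hXY x
    rw [hx hxS] at this
    linarith
  obtain ⟨x, h1, h2⟩ := ((hfull 0 1).and (hfull 1 0)).exists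
  have : x ∈ S 0 1 ∩ S 1 0 := ⟨h1, h2⟩
  rw [hS.antisymm 0 1 (by norm_num)] at this
  exact this

end IsAmpliation

end Products

/-! ### The Hilbert tensor product as an instance of the abstract ampliation -/

section HilbertTensor

variable {H K : Type*}
  [NormedAddCommGroup H] [InnerProductSpace ℂ H] [CompleteSpace H]
  [NormedAddCommGroup K] [InnerProductSpace ℂ K]

theorem isAmpliation_embed (ε : HilbertBasis ℕ ℂ K) :
    IsAmpliation (fun n => embed H (ε n)) (fun A : H →L[ℂ] H => tensorOp A (1 : K →L[ℂ] K)) where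
  adjoint_apply := adjoint_embed_basis ε
  amp_apply A i h := tensorOp_one_embed A (ε i) h
  adjoint_amp A i v := adjoint_embed_tensorOp_one A (ε i) v
  ext _ _ h := eq_of_forall_adjoint_embed ε h

theorem blockProj_eq_summandProj (ε : HilbertBasis ℕ ℂ K) :
    blockProj H ε = summandProj fun n => embed H (ε n) :=
  funext fun i => blockProj_eq ε i

theorem systemSpace_eq (𝒩₀ : Set (H →L[ℂ] H)) (E : ProjectionValuedMeasure H)
    (ε : HilbertBasis ℕ ℂ K) (S : ℕ → ℕ → Set I) :
    systemSpace 𝒩₀ E ε S = ampSystemSpace (fun n => embed H (ε n))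
      (fun A : H →L[ℂ] H => tensorOp A (1 : K →L[ℂ] K)) 𝒩₀ E S := by
  rw [systemSpace, blockProj_eq_summandProj]
  rfl

end HilbertTensor

end TriangularSpaces

theorem mainTheorem7 {H K : Type*}
    [NormedAddCommGroup H] [InnerProductSpace ℂ H] [CompleteSpace H]
    [TopologicalSpace.SeparableSpace H]
    [NormedAddCommGroup K] [InnerProductSpace ℂ K] [CompleteSpace K]
    (hH : ¬ FiniteDimensional ℂ H)
    (𝒩₀ : Set (H →L[ℂ] H))
    (hcont : TriangularSpaces.IsContinuousNest 𝒩₀)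
    (hmult : TriangularSpaces.IsMultiplicityFree 𝒩₀)
    (E : TriangularSpaces.ProjectionValuedMeasure H)
    (hE : TriangularSpaces.IsSpectralMeasure E 𝒩₀)
    (ε : HilbertBasis ℕ ℂ K)
    (S : ℕ → ℕ → Set unitInterval)
    (hS : TriangularSpaces.IsTriangularSystem S) :
    TriangularSpaces.IsTriangularSpace (TriangularSpaces.systemSpace 𝒩₀ E ε S) ∧
    IsClosed (TriangularSpaces.systemSpace 𝒩₀ E ε S) ∧
    (¬ ∀ X ∈ TriangularSpaces.systemSpace 𝒩₀ E ε S,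
        ∀ Y ∈ TriangularSpaces.systemSpace 𝒩₀ E ε S,
          X * Y ∈ TriangularSpaces.systemSpace 𝒩₀ E ε S) ∧
    ∀ i j : ℕ, ∃ X ∈ TriangularSpaces.systemSpace 𝒩₀ E ε S,
      ∃ Y ∈ TriangularSpaces.systemSpace 𝒩₀ E ε S,
        TriangularSpaces.blockProj H ε i * X = X ∧
        Y * TriangularSpaces.blockProj H ε j = Y ∧
        (∃ α β γ : ℕ → TriangularSpaces.HilbertTensor H K,
          Orthonormal ℂ α ∧ Orthonormal ℂ β ∧ Orthonormal ℂ γ ∧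
          (∀ v, HasSum (fun n => InnerProductSpace.rankOne ℂ (α n) (β n) v) (X v)) ∧
          (∀ v, HasSum (fun n => InnerProductSpace.rankOne ℂ (β n) (γ n) v) (Y v))) ∧
        ∀ x : unitInterval,
          1 ≤ TriangularSpaces.diagSeminorm (TriangularSpaces.nestProj K E) x
            (TriangularSpaces.blockProj H ε i * (X * Y) * TriangularSpaces.blockProj H ε j) := by
  have hJ := TriangularSpaces.isAmpliation_embed (H := H) ε
  rw [TriangularSpaces.systemSpace_eq, TriangularSpaces.blockProj_eq_summandProj]
  exact ⟨hJ.isTriangularSpace hE hmult hS, hJ.isClosed_systemSpace hE S, hJ.not_mul_mem hE hS,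
    hJ.exists_factors hE S⟩
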